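/- Let $d\ge 1$ and let $f:\mathbb{R}^d\to\mathbb{R}$ be convex and three times continuously differentiable. For constants $L_1,L_2,L_3>0$ assume that, for all $y,z\in\mathbb{R}^d$, $$\|\nabla f(y)-\nabla f(z)\|\le L_1\|y-z\|,\qquad \max_{\|w\|\le 1}\bigl|w^\top\nabla^2 f(y)w-w^\top\nabla^2 f(z)w\bigr|\le L_2\|y-z\|,\qquad \max_{\|w\|\le 1}\bigl|\nabla^3 f(y)[w]^3-\nabla^3 f(z)[w]^3\bigr|\le L_3\|y-z\|,$$ where $\nabla^3 f(x)[w]^3=\sum_{i,j,k}\frac{\partial^3 f(x)}{\partial x_i\partial x_j\partial x_k}w_iw_jw_k$. Let $\eta=\frac{1}{8(d+6)L_1}$, and let $\lambda>0$ satisfy $\lambda^2\le \frac{\sqrt2\,L_1}{d^{3/2}L_3}$. Put $F(x)=f(x)+\frac{\lambda^2}{2}\operatorname{tr}\bigl(\nabla^2 f(x)\bigr)$, and suppose that $F$ has a minimizer $x_F^*\in\arg\min_{x\in\mathbb{R}^d}F(x)$. Given $x_0\in\mathbb{R}^d$ and an integer $T\ge 1$, run zeroth-order optimization with the two-point estimator,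 $$x_{t+1}=x_t-\eta\,\frac{f(x_t+\lambda u_t)-f(x_t-\lambda u_t)}{2\lambda}\,u_t,\qquad t=0,1,\dots,T-1,$$ where $u_0,\dots,u_{T-1}$ are independent standard Gaussian vectors $\mathcal{N}(0,\mathrm{I}_d)$, and let $\tau$ be uniformly distributed on $\{0,1,\dots,T-1\}$ and independent of $u_0,\dots,u_{T-1}$. Then $F(x_\tau)-\min_{x\in\mathbb{R}^d} F(x)$ is integrable and $$\mathbb{E}\Bigl[F(x_\tau)-\min_{x\in\mathbb{R}^d}F(x)\Bigr]\le \frac{8(d+6)L_1\|x_0-x_F^*\|^2}{T}+\frac{L_3}{6}\lambda^4(d+4)^2+\frac{L_2^2}{24L_1}\lambda^4(d+6)^3+\frac{L_3^2}{1152L_1}\lambda^6(d+10)^4,$$ where the expectation is over $u_0,\dots,u_{T-1}$ and $\tau$. -/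

import Mathlib

open MeasureTheory ProbabilityTheory

noncomputable section

/-- The Hessian matrix `∇²f(x)`, with entries `∂²f(x)/∂xᵢ∂xⱼ`. -/
def hessian {d : ℕ} (f : EuclideanSpace ℝ (Fin d) → ℝ) (x : EuclideanSpace ℝ (Fin d)) :
    Matrix (Fin d) (Fin d) ℝ :=
  Matrix.of fun i j =>
    iteratedFDeriv ℝ 2 f x ![EuclideanSpace.single i 1, EuclideanSpace.single j 1]

/-- The regularized loss `F(x) = f(x) + (λ²/2) tr ∇²f(x)`. -/
def regLoss {d : ℕ} (f : EuclideanSpace ℝ (Fin d) → ℝ) (lam : ℝ)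
    (x : EuclideanSpace ℝ (Fin d)) : ℝ :=
  f x + lam ^ 2 / 2 * (hessian f x).trace

/-- `f` is `L`-smooth: the gradient is `L`-Lipschitz. -/
def FirstOrderSmooth {d : ℕ} (f : EuclideanSpace ℝ (Fin d) → ℝ) (L : ℝ) : Prop :=
  ∀ y z, ‖gradient f y - gradient f z‖ ≤ L * ‖y - z‖

/-- Second-order smoothness: `‖∇²f(y) - ∇²f(z)‖ ≤ L ‖y - z‖` for all `y, z`, where the norm of a
symmetric matrix `M` is `max_{‖w‖ ≤ 1} |wᵀ M w|`. -/
def SecondOrderSmooth {d : ℕ} (f : EuclideanSpace ℝ (Fin d) → ℝ) (L : ℝ) : Prop :=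
  ∀ y z w : EuclideanSpace ℝ (Fin d), ‖w‖ ≤ 1 →
    |iteratedFDeriv ℝ 2 f y (fun _ => w) - iteratedFDeriv ℝ 2 f z (fun _ => w)| ≤ L * ‖y - z‖

/-- Third-order smoothness: `‖∇³f(y) - ∇³f(z)‖ ≤ L ‖y - z‖` for all `y, z`, where the norm of a
symmetric trilinear form `A` is `max_{‖w‖ ≤ 1} |A[w, w, w]|`. -/
def ThirdOrderSmooth {d : ℕ} (f : EuclideanSpace ℝ (Fin d) → ℝ) (L : ℝ) : Prop :=
  ∀ y z w : EuclideanSpace ℝ (Fin d), ‖w‖ ≤ 1 →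
    |iteratedFDeriv ℝ 3 f y (fun _ => w) - iteratedFDeriv ℝ 3 f z (fun _ => w)| ≤ L * ‖y - z‖

/-- The two-point estimator `g_λ(x, u) = ((f(x + λu) - f(x - λu)) / (2λ)) u`. -/
def twoPoint {d : ℕ} (f : EuclideanSpace ℝ (Fin d) → ℝ) (lam : ℝ)
    (x u : EuclideanSpace ℝ (Fin d)) : EuclideanSpace ℝ (Fin d) :=
  ((f (x + lam • u) - f (x - lam • u)) / (2 * lam)) • u

/-- The iterates `x_{t+1} = x_t - η g_λ(x_t, u_t)` of zeroth-order optimization, started at `x₀`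
and run along the search directions `u₀, u₁, …`. -/
def zoIterate {d : ℕ} (f : EuclideanSpace ℝ (Fin d) → ℝ) (η lam : ℝ)
    (x₀ : EuclideanSpace ℝ (Fin d)) (u : ℕ → EuclideanSpace ℝ (Fin d)) :
    ℕ → EuclideanSpace ℝ (Fin d)
  | 0 => x₀
  | t + 1 => zoIterate f η lam x₀ u t - η • twoPoint f lam (zoIterate f η lam x₀ u t) (u t)

end

/-! Write f_λ(x) = E f(x + λu) for the Gaussian smoothing and g for the two-point estimator.
Gaussian integration by parts shows that g is unbiased for ∇f_λ, and f_λ inherits convexity from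
`f`. In the third-order Taylor expansion of f(x + λu) the odd terms average to zero and the
quadratic one averages to the trace term of F, so |f_λ - F| is at most L₃λ⁴d(d+2)/24. Hence E⟨g, x -
x_F⟩ ≥ F(x) - F(x_F) up to order λ⁴, although F itself need not be convex.

For the second moment, the symmetric difference quotient equals ⟨u, ∇F(x)⟩ plus corrections of order
λ² and λ³, and E⟨u, v⟩²‖u‖² = (d+2)‖v‖² turns the main part into 2(d+2)‖∇F(x)‖². The restriction on
λ makes ∇F Lipschitz with constant 2L₁, so ‖∇F(x)‖² ≤ 4L₁(F(x) - min F).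

Expanding the squared distance to x_F after one step gives -2η(F - min F) from the inner product; by
the choice of η, the term η²E‖g‖² costs at most one η(F - min F) plus errors. One copy survives.
Telescoping over t, dividing by ηT and averaging over τ gives the bound.

The argument rests on `integral_inner_twoPoint`, `abs_smoothing_sub_regLoss_le`,
`regLoss_gradient_lipschitz`, `integral_sq_norm_twoPoint_le`, `integral_sq_dist_step_le` and
`sum_lintegral_zoIterate_le`. -/

/-! ### Gaussian density, Stein's identity and moments. -/

section GaussianMeasure

open scoped RealInnerProductSpace

variable {V : Type*} [NormedAddCommGroup V] [InnerProductSpace ℝ V] [FiniteDimensional ℝ V]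
  [MeasurableSpace V] [BorelSpace V]

lemma integral_exp_neg_half_sq_norm_pos :
    0 < ∫ x : V, Real.exp (-(1 / 2) * ‖x‖ ^ 2) := by
  rw [GaussianFourier.integral_rexp_neg_mul_sq_norm (by norm_num)]
  positivity

/-- Both sides have the same characteristic function. The density gives access to integration by
parts against Lebesgue measure. -/
lemma stdGaussian_eq_withDensity :
    stdGaussian V = (volume : Measure V).withDensity (fun x => ENNReal.ofReal
      ((∫ y : V, Real.exp (-(1 / 2) * ‖y‖ ^ 2))⁻¹ * Real.exp (-(1 / 2) * ‖x‖ ^ 2))) := by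
  set Z := ∫ y : V, Real.exp (-(1 / 2) * ‖y‖ ^ 2) with hZ
  have hZpos : 0 < Z := integral_exp_neg_half_sq_norm_pos
  have hint : Integrable (fun x : V => Real.exp (-(1 / 2) * ‖x‖ ^ 2)) :=
    Integrable.of_integral_ne_zero hZpos.ne'
  have : IsFiniteMeasure ((volume : Measure V).withDensity (fun x => ENNReal.ofReal
      (Z⁻¹ * Real.exp (-(1 / 2) * ‖x‖ ^ 2)))) :=
    isFiniteMeasure_withDensity_ofReal (hint.const_mul _).2
  apply Measure.ext_of_charFun
  ext t
  rw [charFun_stdGaussian, charFun_apply, integral_withDensity_eq_integral_toReal_smul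
    (by fun_prop) (by simp)]
  have h1 : ∀ x : V, (ENNReal.ofReal (Z⁻¹ * Real.exp (-(1 / 2) * ‖x‖ ^ 2))).toReal •
      Complex.exp (⟪x, t⟫ * Complex.I) =
      (Z : ℂ)⁻¹ * Complex.exp (-(1 / 2 : ℂ) * ‖x‖ ^ 2 + Complex.I * ⟪t, x⟫) := by
    intro x
    rw [ENNReal.toReal_ofReal (by positivity), Complex.exp_add, real_inner_comm,
      Complex.real_smul]
    push_cast
    rw [mul_assoc, mul_comm Complex.I]
  simp_rw [h1]
  rw [integral_const_mul, GaussianFourier.integral_cexp_neg_mul_sq_norm_add (by norm_num)]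
  have h2 : (Z : ℂ) = (Real.pi / (1 / 2 : ℂ)) ^ (Module.finrank ℝ V / 2 : ℂ) := by
    rw [hZ, ← GaussianFourier.integral_cexp_neg_mul_sq_norm (by norm_num), ← integral_complex_ofReal]
    congr 1; ext x; push_cast; rfl
  have hZ0 : (Z : ℂ) ≠ 0 := by exact_mod_cast hZpos.ne'
  rw [← h2, inv_mul_cancel_left₀ hZ0]
  congr 1
  rw [Complex.I_sq]; ring

lemma integrable_stdGaussian_iff {φ : V → ℝ} :
    Integrable φ (stdGaussian V) ↔
      Integrable (fun x => φ x * Real.exp (-(1 / 2) * ‖x‖ ^ 2)) := by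
  have hZ : 0 < ∫ y : V, Real.exp (-(1 / 2) * ‖y‖ ^ 2) := integral_exp_neg_half_sq_norm_pos
  rw [stdGaussian_eq_withDensity, integrable_withDensity_iff_integrable_smul' (by fun_prop)
    (by simp)]
  rw [← integrable_const_mul_iff (c := (∫ y : V, Real.exp (-(1 / 2) * ‖y‖ ^ 2))⁻¹)
    (isUnit_iff_ne_zero.2 (inv_pos.2 hZ).ne') (fun x => φ x * Real.exp (-(1 / 2) * ‖x‖ ^ 2))]
  refine iff_of_eq (congrArg (fun g => Integrable g volume) ?_)
  ext x
  rw [ENNReal.toReal_ofReal (by positivity), smul_eq_mul]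
  ring

lemma integral_stdGaussian (φ : V → ℝ) :
    ∫ x, φ x ∂(stdGaussian V) = (∫ y : V, Real.exp (-(1 / 2) * ‖y‖ ^ 2))⁻¹ *
      ∫ x : V, φ x * Real.exp (-(1 / 2) * ‖x‖ ^ 2) := by
  have hZ : 0 < ∫ y : V, Real.exp (-(1 / 2) * ‖y‖ ^ 2) := integral_exp_neg_half_sq_norm_pos
  rw [← integral_const_mul]
  conv_lhs => rw [stdGaussian_eq_withDensity]
  rw [integral_withDensity_eq_integral_toReal_smul (by fun_prop) (by simp)]
  congr 1; ext x
  rw [ENNReal.toReal_ofReal (by positivity), smul_eq_mul]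
  ring

/-- **Stein's identity**: Gaussian integration by parts. -/
lemma integral_fderiv_stdGaussian {φ : V → ℝ} (hφ : Differentiable ℝ φ) (w : V)
    (h0 : Integrable φ (stdGaussian V))
    (h1 : Integrable (fun x => fderiv ℝ φ x w) (stdGaussian V))
    (h2 : Integrable (fun x => φ x * ⟪x, w⟫) (stdGaussian V)) :
    ∫ x, fderiv ℝ φ x w ∂(stdGaussian V) = ∫ x, φ x * ⟪x, w⟫ ∂(stdGaussian V) := by
  rw [integrable_stdGaussian_iff] at h0 h1 h2
  have hd : ∀ x : V, HasFDerivAt (fun x : V => Real.exp (-(1 / 2) * ‖x‖ ^ 2))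
      (-Real.exp (-(1 / 2) * ‖x‖ ^ 2) • innerSL ℝ x) x := by
    intro x
    have := (((hasStrictFDerivAt_norm_sq x).hasFDerivAt).const_mul (-(1 / 2) : ℝ)).exp
    convert this using 1
    ext v
    simp
  have hd' : ∀ x : V, fderiv ℝ (fun x : V => Real.exp (-(1 / 2) * ‖x‖ ^ 2)) x w =
      -(⟪x, w⟫ * Real.exp (-(1 / 2) * ‖x‖ ^ 2)) := by
    intro x
    rw [(hd x).fderiv]
    simp
    ring
  have key := integral_mul_fderiv_eq_neg_fderiv_mul_of_integrable (μ := (volume : Measure V))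
    (f := φ) (g := fun x : V => Real.exp (-(1 / 2) * ‖x‖ ^ 2)) (v := w) h1
    (by simp_rw [hd', mul_neg, ← mul_assoc]; exact h2.neg) h0
    (fun x _ => hφ x) (fun x _ => (hd x).differentiableAt)
  rw [integral_stdGaussian, integral_stdGaussian]
  congr 1
  simp_rw [hd', mul_neg, integral_neg, neg_inj, ← mul_assoc] at key
  exact key.symm

lemma integrable_stdGaussian_of_growth {φ : V → ℝ} (hφ : AEStronglyMeasurable φ (stdGaussian V))
    (C : ℝ) (k : ℕ) (h : ∀ x, |φ x| ≤ C * (1 + ‖x‖) ^ k) : Integrable φ (stdGaussian V) := by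
  have h1 : MemLp (fun x : V => 1 + ‖x‖) k (stdGaussian V) :=
    (memLp_const (1 : ℝ)).add (IsGaussian.memLp_id (stdGaussian V) k (ENNReal.natCast_ne_top k)).norm
  have h2 : Integrable (fun x : V => C * (1 + ‖x‖) ^ k) (stdGaussian V) := by
    have h3 : Integrable (fun x : V => ‖1 + ‖x‖‖ ^ k) (stdGaussian V) := h1.integrable_norm_pow'
    have h4 : ∀ x : V, ‖1 + ‖x‖‖ = 1 + ‖x‖ := fun x => Real.norm_of_nonneg (by positivity)
    simp_rw [h4] at h3
    exact h3.const_mul C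
  exact h2.mono' hφ (.of_forall h)

lemma integrable_inner_mul_inner_mul_norm_pow (v w : V) (k : ℕ) :
    Integrable (fun x => ⟪x, v⟫ * ⟪x, w⟫ * (‖x‖ ^ 2) ^ k) (stdGaussian V) := by
  refine integrable_stdGaussian_of_growth (Continuous.aestronglyMeasurable (by fun_prop))
    (‖v‖ * ‖w‖) (2 * k + 2) fun x => ?_
  rw [abs_mul, abs_mul, abs_of_nonneg (a := (‖x‖ ^ 2) ^ k) (by positivity)]
  have hx := norm_nonneg x
  calc |⟪x, v⟫| * |⟪x, w⟫| * (‖x‖ ^ 2) ^ k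
      ≤ (‖x‖ * ‖v‖) * (‖x‖ * ‖w‖) * (‖x‖ ^ 2) ^ k := by
        gcongr <;> exact abs_real_inner_le_norm _ _
    _ = ‖v‖ * ‖w‖ * ‖x‖ ^ (2 * k + 2) := by ring
    _ ≤ ‖v‖ * ‖w‖ * (1 + ‖x‖) ^ (2 * k + 2) := by gcongr; linarith

lemma integrable_norm_pow_stdGaussian (k : ℕ) :
    Integrable (fun x : V => ‖x‖ ^ k) (stdGaussian V) :=
  integrable_stdGaussian_of_growth (Continuous.aestronglyMeasurable (by fun_prop)) 1 k fun x => by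
    rw [abs_of_nonneg (by positivity), one_mul]
    gcongr
    linarith

/-- Stein's identity in direction `w` for ⟪x, v⟫‖x‖^(2k). At `k = 0` the truncated exponent `k - 1`
is harmless, since its coefficient 2k vanishes. -/
lemma integral_inner_mul_inner_mul_norm_pow (v w : V) (k : ℕ) :
    ∫ x, ⟪x, v⟫ * ⟪x, w⟫ * (‖x‖ ^ 2) ^ k ∂(stdGaussian V) =
      ⟪v, w⟫ * ∫ x, (‖x‖ ^ 2) ^ k ∂(stdGaussian V) +
        2 * k * ∫ x, ⟪x, v⟫ * ⟪x, w⟫ * (‖x‖ ^ 2) ^ (k - 1) ∂(stdGaussian V) := by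
  have hd : ∀ x : V, HasFDerivAt (fun x : V => ⟪x, v⟫ * (‖x‖ ^ 2) ^ k)
      (⟪x, v⟫ • (k • (‖x‖ ^ 2) ^ (k - 1)) • (2 • innerSL ℝ x) +
        (‖x‖ ^ 2) ^ k • innerSL ℝ v) x := by
    intro x
    have h1 : HasFDerivAt (fun x : V => ⟪x, v⟫) (innerSL ℝ v) x := by
      simp_rw [real_inner_comm v]
      exact (innerSL ℝ v).hasFDerivAt
    have h2 := ((hasStrictFDerivAt_norm_sq x).hasFDerivAt (x := x)).pow k
    exact h1.mul h2
  have hd' : ∀ x : V, fderiv ℝ (fun x : V => ⟪x, v⟫ * (‖x‖ ^ 2) ^ k) x w =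
      ⟪v, w⟫ * (‖x‖ ^ 2) ^ k + 2 * k * (⟪x, v⟫ * ⟪x, w⟫ * (‖x‖ ^ 2) ^ (k - 1)) := by
    intro x
    rw [(hd x).fderiv]
    simp
    ring
  have hi1 : Integrable (fun x : V => (‖x‖ ^ 2) ^ k) (stdGaussian V) := by
    simp_rw [← pow_mul]; exact integrable_norm_pow_stdGaussian _
  have hi2 := integrable_inner_mul_inner_mul_norm_pow v w (k - 1)
  have h0 : Integrable (fun x : V => ⟪x, v⟫ * (‖x‖ ^ 2) ^ k) (stdGaussian V) := by
    refine integrable_stdGaussian_of_growth (Continuous.aestronglyMeasurable (by fun_prop))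
      ‖v‖ (2 * k + 1) fun x => ?_
    rw [abs_mul, abs_of_nonneg (a := (‖x‖ ^ 2) ^ k) (by positivity)]
    have hx := norm_nonneg x
    calc |⟪x, v⟫| * (‖x‖ ^ 2) ^ k ≤ (‖x‖ * ‖v‖) * (‖x‖ ^ 2) ^ k := by
          gcongr; exact abs_real_inner_le_norm _ _
      _ = ‖v‖ * ‖x‖ ^ (2 * k + 1) := by ring
      _ ≤ ‖v‖ * (1 + ‖x‖) ^ (2 * k + 1) := by gcongr; linarith
  have key := integral_fderiv_stdGaussian (φ := fun x : V => ⟪x, v⟫ * (‖x‖ ^ 2) ^ k)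
    (fun x => (hd x).differentiableAt) w h0
    (by simp_rw [hd']; exact (hi1.const_mul _).add (hi2.const_mul _))
    (by simpa only [mul_right_comm] using integrable_inner_mul_inner_mul_norm_pow v w k)
  simp_rw [hd'] at key
  rw [integral_add (hi1.const_mul _) (hi2.const_mul _), integral_const_mul,
    integral_const_mul] at key
  simp_rw [mul_right_comm _ _ ((‖_‖ ^ 2) ^ k)] at key ⊢
  exact key.symm

lemma integral_inner_mul_inner_stdGaussian (v w : V) :
    ∫ x, ⟪x, v⟫ * ⟪x, w⟫ ∂(stdGaussian V) = ⟪v, w⟫ := by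
  simpa using integral_inner_mul_inner_mul_norm_pow v w 0

/-- Take v = w in the previous recursion and sum over an orthonormal basis: the first term produces
the dimension, the second reassembles to 2k times the same moment. -/
lemma integral_norm_pow_succ_stdGaussian (k : ℕ) :
    ∫ x : V, (‖x‖ ^ 2) ^ (k + 1) ∂(stdGaussian V) =
      (Module.finrank ℝ V + 2 * k) * ∫ x : V, (‖x‖ ^ 2) ^ k ∂(stdGaussian V) := by
  have hsum : ∀ (x : V) (m : ℕ), (‖x‖ ^ 2) ^ (m + 1) = ∑ i, ⟪x, stdOrthonormalBasis ℝ V i⟫ *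
      ⟪x, stdOrthonormalBasis ℝ V i⟫ * (‖x‖ ^ 2) ^ m := by
    intro x m
    rw [← Finset.sum_mul, pow_succ' _ m, ← (stdOrthonormalBasis ℝ V).sum_sq_inner_left x]
    simp_rw [sq]
  have h : ∀ m, ∫ x : V, (‖x‖ ^ 2) ^ (m + 1) ∂(stdGaussian V) =
      ∑ i, ∫ x : V, ⟪x, stdOrthonormalBasis ℝ V i⟫ *
        ⟪x, stdOrthonormalBasis ℝ V i⟫ * (‖x‖ ^ 2) ^ m ∂(stdGaussian V) := by
    intro m
    simp_rw [hsum _ m]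
    exact integral_finsetSum _ fun i _ => integrable_inner_mul_inner_mul_norm_pow _ _ m
  rw [h]
  simp_rw [integral_inner_mul_inner_mul_norm_pow _ _ k]
  rw [Finset.sum_add_distrib, ← Finset.mul_sum, ← Finset.sum_mul]
  rcases k with _ | k
  · simp
  · rw [Nat.add_sub_cancel, ← h k]
    simp
    ring

lemma integral_norm_sq_pow_stdGaussian (k : ℕ) :
    ∫ x : V, (‖x‖ ^ 2) ^ k ∂(stdGaussian V) =
      ∏ j ∈ Finset.range k, ((Module.finrank ℝ V : ℝ) + 2 * j) := by
  induction k with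
  | zero => simp
  | succ k ih => rw [integral_norm_pow_succ_stdGaussian, ih, Finset.prod_range_succ, mul_comm]

lemma integral_sq_inner_mul_norm_sq_stdGaussian (v : V) :
    ∫ x, ⟪x, v⟫ ^ 2 * ‖x‖ ^ 2 ∂(stdGaussian V) = (Module.finrank ℝ V + 2) * ‖v‖ ^ 2 := by
  have h := integral_inner_mul_inner_mul_norm_pow v v 1
  rw [integral_norm_sq_pow_stdGaussian] at h
  simp only [Nat.sub_self, pow_zero, mul_one, integral_inner_mul_inner_stdGaussian,
    Finset.prod_range_one, real_inner_self_eq_norm_sq, pow_one] at h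
  simp_rw [sq ⟪_, v⟫, h]
  push_cast
  ring

lemma integral_comp_neg_stdGaussian (φ : V → ℝ) :
    ∫ x, φ (-x) ∂(stdGaussian V) = ∫ x, φ x ∂(stdGaussian V) := by
  have h : MeasurePreserving (LinearIsometryEquiv.neg ℝ : V ≃ₗᵢ[ℝ] V) (stdGaussian V)
      (stdGaussian V) :=
    ⟨(LinearIsometryEquiv.neg ℝ).continuous.measurable, stdGaussian_map _⟩
  exact h.integral_comp (LinearIsometryEquiv.neg ℝ).toHomeomorph.measurableEmbedding φ

end GaussianMeasure

/-! ### Taylor estimates in one variable. -/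

section LineTaylor

/-- Integrating a power bound on a derivative over `[0, 1]`. -/
lemma abs_le_of_abs_deriv_le_pow {ψ ψ' : ℝ → ℝ} {C : ℝ} {n : ℕ} (h : ∀ s, HasDerivAt ψ (ψ' s) s)
    (h0 : ψ 0 = 0) (hb : ∀ s ∈ Set.Icc (0 : ℝ) 1, |ψ' s| ≤ C * s ^ n) :
    ∀ s ∈ Set.Icc (0 : ℝ) 1, |ψ s| ≤ C / (n + 1) * s ^ (n + 1) := by
  have hn : (n : ℝ) + 1 ≠ 0 := by positivity
  refine image_norm_le_of_norm_deriv_right_le_deriv_boundary (f := ψ) (f' := ψ')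
    (B' := fun s => C * s ^ n) (fun s _ => (h s).continuousAt.continuousWithinAt)
    (fun s _ => (h s).hasDerivWithinAt) (by simp [h0]) (fun s => ?_)
    (fun s hs => hb s ⟨hs.1, hs.2.le⟩)
  have := (hasDerivAt_pow (n + 1) s).const_mul (C / (n + 1))
  refine this.congr_deriv ?_
  rw [Nat.add_sub_cancel]
  push_cast
  rw [← mul_assoc, div_mul_cancel₀ _ hn]

lemma abs_sub_sub_le_of_lipschitz_deriv {φ φ₁ : ℝ → ℝ} {M : ℝ} (h : ∀ s, HasDerivAt φ (φ₁ s) s)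
    (hM : ∀ s ∈ Set.Icc (0 : ℝ) 1, |φ₁ s - φ₁ 0| ≤ M * s) :
    |φ 1 - φ 0 - φ₁ 0| ≤ M / 2 := by
  have key := abs_le_of_abs_deriv_le_pow (ψ := fun s => φ s - φ 0 - φ₁ 0 * s)
    (ψ' := fun s => φ₁ s - φ₁ 0) (C := M) (n := 1)
    (fun s => by
      have := ((h s).sub_const (φ 0)).sub ((hasDerivAt_id s).const_mul (φ₁ 0))
      exact this.congr_deriv (by simp))
    (by simp) (by simpa using hM) 1 (by simp)
  norm_num at key
  linarith

/-- Third-order Taylor expansion on `[0, 1]` with Lipschitz third derivative. -/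
lemma abs_taylor_three_le {φ φ₁ φ₂ φ₃ : ℝ → ℝ} {M : ℝ} (h : ∀ s, HasDerivAt φ (φ₁ s) s)
    (h₁ : ∀ s, HasDerivAt φ₁ (φ₂ s) s) (h₂ : ∀ s, HasDerivAt φ₂ (φ₃ s) s)
    (hM : ∀ s ∈ Set.Icc (0 : ℝ) 1, |φ₃ s - φ₃ 0| ≤ M * s) :
    |φ 1 - φ 0 - φ₁ 0 - φ₂ 0 / 2 - φ₃ 0 / 6| ≤ M / 24 := by
  have k2 := abs_le_of_abs_deriv_le_pow (ψ := fun s => φ₂ s - φ₂ 0 - φ₃ 0 * s)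
    (ψ' := fun s => φ₃ s - φ₃ 0) (C := M) (n := 1)
    (fun s => by
      have := ((h₂ s).sub_const (φ₂ 0)).sub ((hasDerivAt_id s).const_mul (φ₃ 0))
      exact this.congr_deriv (by simp))
    (by simp) (by simpa using hM)
  have k1 := abs_le_of_abs_deriv_le_pow
    (ψ := fun s => φ₁ s - φ₁ 0 - φ₂ 0 * s - φ₃ 0 / 2 * s ^ 2)
    (ψ' := fun s => φ₂ s - φ₂ 0 - φ₃ 0 * s) (n := 2)
    (fun s => by
      have := (((h₁ s).sub_const (φ₁ 0)).sub ((hasDerivAt_id s).const_mul (φ₂ 0))).sub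
        ((hasDerivAt_pow 2 s).const_mul (φ₃ 0 / 2))
      refine this.congr_deriv ?_
      simp
      ring)
    (by simp) k2
  have k0 := abs_le_of_abs_deriv_le_pow
    (ψ := fun s => φ s - φ 0 - φ₁ 0 * s - φ₂ 0 / 2 * s ^ 2 - φ₃ 0 / 6 * s ^ 3)
    (ψ' := fun s => φ₁ s - φ₁ 0 - φ₂ 0 * s - φ₃ 0 / 2 * s ^ 2) (n := 3)
    (fun s => by
      have := ((((h s).sub_const (φ 0)).sub ((hasDerivAt_id s).const_mul (φ₁ 0))).sub
        ((hasDerivAt_pow 2 s).const_mul (φ₂ 0 / 2))).sub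
        ((hasDerivAt_pow 3 s).const_mul (φ₃ 0 / 6))
      refine this.congr_deriv ?_
      simp
      ring)
    (by simp) k1 1 (by simp)
  norm_num at k0
  linarith

end LineTaylor

/-! ### Symmetry, polarization and bounds for the third derivative. -/

section HigherDerivatives

lemma const_eq_vecCons_two {V : Type*} (v : V) : (fun _ : Fin 2 => v) = ![v, v] := by
  ext i; fin_cases i <;> rfl

lemma const_eq_vecCons_three {V : Type*} (v : V) : (fun _ : Fin 3 => v) = ![v, v, v] := by
  ext i; fin_cases i <;> rfl

variable {V : Type*} [NormedAddCommGroup V] [NormedSpace ℝ V] {f : V → ℝ}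

lemma hasDerivAt_iteratedFDeriv_line {n : WithTop ℕ∞} {k : ℕ} (hf : ContDiff ℝ n f) (hk : k < n)
    (x v : V) (m : Fin k → V) (s : ℝ) :
    HasDerivAt (fun s : ℝ => iteratedFDeriv ℝ k f (x + s • v) m)
      (iteratedFDeriv ℝ (k + 1) f (x + s • v) (Fin.cons v m)) s := by
  have h1 : HasDerivAt (fun s : ℝ => x + s • v) v s := by
    simpa using ((hasDerivAt_id s).smul_const v).const_add x
  have h2 := (hf.differentiable_iteratedFDeriv hk (x + s • v)).hasFDerivAt.comp_hasDerivAt s h1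
  have h3 := (ContinuousMultilinearMap.apply ℝ (fun _ : Fin k => V) ℝ m).hasFDerivAt.comp_hasDerivAt
    s h2
  exact h3

/-- The third derivative as a trilinear form. -/
noncomputable def thirdDeriv (f : V → ℝ) (x u v w : V) : ℝ := iteratedFDeriv ℝ 3 f x ![u, v, w]

lemma iteratedFDeriv_three_const (f : V → ℝ) (x v : V) :
    iteratedFDeriv ℝ 3 f x (fun _ => v) = thirdDeriv f x v v v :=
  congrArg (iteratedFDeriv ℝ 3 f x) (const_eq_vecCons_three v)

lemma hasDerivAt_second_line (hf : ContDiff ℝ 3 f) (x u v w : V) (s : ℝ) :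
    HasDerivAt (fun s : ℝ => iteratedFDeriv ℝ 2 f (x + s • u) ![v, w])
      (thirdDeriv f (x + s • u) u v w) s :=
  hasDerivAt_iteratedFDeriv_line hf (by norm_num) x u ![v, w] s

lemma iteratedFDeriv_two_symm (hf : ContDiff ℝ 3 f) (x v w : V) :
    iteratedFDeriv ℝ 2 f x ![v, w] = iteratedFDeriv ℝ 2 f x ![w, v] := by
  have h : IsSymmSndFDerivAt ℝ f x :=
    hf.contDiffAt.isSymmSndFDerivAt (by simp; norm_num)
  exact IsSymmSndFDerivAt.iteratedFDeriv_cons (hf := h)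

/-- Both sides are the derivative along `u` of the same symmetric Hessian entry. -/
lemma thirdDeriv_swap_right (hf : ContDiff ℝ 3 f) (x u v w : V) :
    thirdDeriv f x u v w = thirdDeriv f x u w v := by
  have h1 := hasDerivAt_second_line hf x u v w 0
  have h2 := hasDerivAt_second_line hf x u w v 0
  simp_rw [iteratedFDeriv_two_symm hf _ v w] at h1
  simpa using h1.unique h2

/-- Symmetry of the second derivative of `fderiv ℝ f`, evaluated at the last argument. -/
lemma thirdDeriv_swap_left (hf : ContDiff ℝ 3 f) (x u v w : V) :
    thirdDeriv f x u v w = thirdDeriv f x v u w := by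
  have hf' : ContDiff ℝ 2 (fderiv ℝ f) := hf.fderiv_right (by norm_num)
  have h : IsSymmSndFDerivAt ℝ (fderiv ℝ f) x :=
    hf'.contDiffAt.isSymmSndFDerivAt (by simp)
  have e : ∀ a b, thirdDeriv f x a b w = iteratedFDeriv ℝ 2 (fderiv ℝ f) x ![a, b] w := by
    intro a b
    rw [thirdDeriv, iteratedFDeriv_succ_apply_right]
    congr 2
    ext i; fin_cases i <;> rfl
  rw [e, e]
  exact congrArg (fun L : V →L[ℝ] ℝ => L w) (IsSymmSndFDerivAt.iteratedFDeriv_cons (hf := h))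

lemma thirdDeriv_add (x u u' v w : V) :
    thirdDeriv f x (u + u') v w = thirdDeriv f x u v w + thirdDeriv f x u' v w :=
  (iteratedFDeriv ℝ 3 f x).cons_add ![v, w] u u'

lemma thirdDeriv_smul (c : ℝ) (x u v w : V) :
    thirdDeriv f x (c • u) v w = c * thirdDeriv f x u v w :=
  (iteratedFDeriv ℝ 3 f x).cons_smul ![v, w] c u

/-- In the trilinear expansion the terms odd in `t` cancel. This recovers the mixed entry [v, e, e],
which occurs in the gradient of tr ∇²f, from diagonal values, the only ones the hypotheses control.
-/
lemma thirdDeriv_polarization (hf : ContDiff ℝ 3 f) (x v e : V) (t : ℝ) :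
    thirdDeriv f x (v + t • e) (v + t • e) (v + t • e) +
      thirdDeriv f x (v - t • e) (v - t • e) (v - t • e) - 2 * thirdDeriv f x v v v =
      6 * t ^ 2 * thirdDeriv f x v e e := by
  have a1 := fun u u' v w => thirdDeriv_add (f := f) x u u' v w
  have a2 : ∀ u v v' w, thirdDeriv f x u (v + v') w =
      thirdDeriv f x u v w + thirdDeriv f x u v' w := by
    intro u v v' w
    rw [thirdDeriv_swap_left hf, a1, thirdDeriv_swap_left hf x v, thirdDeriv_swap_left hf x v']
  have a3 : ∀ u v w w', thirdDeriv f x u v (w + w') =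
      thirdDeriv f x u v w + thirdDeriv f x u v w' := by
    intro u v w w'
    rw [thirdDeriv_swap_right hf, a2, thirdDeriv_swap_right hf x u w,
      thirdDeriv_swap_right hf x u w']
  have s1 := fun c u v w => thirdDeriv_smul (f := f) c x u v w
  have s2 : ∀ c u v w, thirdDeriv f x u (c • v) w = c * thirdDeriv f x u v w := by
    intro c u v w
    rw [thirdDeriv_swap_left hf, s1, thirdDeriv_swap_left hf x v]
  have s3 : ∀ c u v w, thirdDeriv f x u v (c • w) = c * thirdDeriv f x u v w := by
    intro c u v w
    rw [thirdDeriv_swap_right hf, s2, thirdDeriv_swap_right hf x u w]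
  rw [sub_eq_add_neg v, ← neg_smul]
  simp only [a1, a2, a3, s1, s2, s3]
  rw [thirdDeriv_swap_right hf x e v e, thirdDeriv_swap_right hf x e e v,
    thirdDeriv_swap_left hf x e v e, thirdDeriv_swap_right hf x v e v,
    thirdDeriv_swap_left hf x e v v]
  ring

lemma iteratedFDeriv_const_smul {k : ℕ} (x w : V) (c : ℝ) :
    iteratedFDeriv ℝ k f x (fun _ => c • w) = c ^ k * iteratedFDeriv ℝ k f x (fun _ => w) := by
  have := (iteratedFDeriv ℝ k f x).map_smul_univ (fun _ => c) (fun _ => w)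
  simpa using this

/-- A Lipschitz bound on the diagonal of the derivative over the unit ball extends by homogeneity. -/
lemma abs_iteratedFDeriv_sub_le_of_unit {k : ℕ} (hk : k ≠ 0) {L : ℝ}
    (h : ∀ y z w : V, ‖w‖ ≤ 1 →
      |iteratedFDeriv ℝ k f y (fun _ => w) - iteratedFDeriv ℝ k f z (fun _ => w)| ≤ L * ‖y - z‖)
    (y z w : V) :
    |iteratedFDeriv ℝ k f y (fun _ => w) - iteratedFDeriv ℝ k f z (fun _ => w)| ≤
      L * ‖y - z‖ * ‖w‖ ^ k := by
  rcases eq_or_ne w 0 with rfl | hw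
  · have : ∀ y, iteratedFDeriv ℝ k f y (fun _ => (0 : V)) = 0 := fun y => by
      have := iteratedFDeriv_const_smul (f := f) (k := k) y (0 : V) 0
      simpa [hk] using this
    simp [this, hk]
  · have hw' : 0 < ‖w‖ := norm_pos_iff.2 hw
    have e : w = ‖w‖ • (‖w‖⁻¹ • w) := by rw [smul_smul, mul_inv_cancel₀ hw'.ne', one_smul]
    have h1 := h y z (‖w‖⁻¹ • w) (by rw [norm_smul, norm_inv, norm_norm, inv_mul_cancel₀ hw'.ne'])
    have h2 : ∀ y, iteratedFDeriv ℝ k f y (fun _ => w) =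
        ‖w‖ ^ k * iteratedFDeriv ℝ k f y (fun _ => ‖w‖⁻¹ • w) := fun y => by
      rw [← iteratedFDeriv_const_smul, ← e]
    rw [h2, h2, ← mul_sub, abs_mul, abs_of_nonneg (a := ‖w‖ ^ k) (by positivity), mul_comm]
    gcongr

/-- A Lipschitz second derivative bounds the third derivative. -/
lemma abs_thirdDeriv_le (hf : ContDiff ℝ 3 f) {L : ℝ}
    (h : ∀ y z w : V, |iteratedFDeriv ℝ 2 f y (fun _ => w) - iteratedFDeriv ℝ 2 f z (fun _ => w)| ≤
      L * ‖y - z‖ * ‖w‖ ^ 2) (x v w : V) :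
    |thirdDeriv f x v w w| ≤ L * ‖v‖ * ‖w‖ ^ 2 := by
  have hd := hasDerivAt_second_line hf x v w w 0
  simp only [← const_eq_vecCons_two, zero_smul, add_zero] at hd
  -- No sign of `L` is assumed; nonnegativity is read off from the Lipschitz bound itself.
  have hL : 0 ≤ L * ‖v‖ * ‖w‖ ^ 2 := by
    have := h (x + v) x w
    rw [add_sub_cancel_left] at this
    exact (abs_nonneg _).trans this
  rw [← Real.norm_eq_abs]
  refine hd.le_of_lip' hL (.of_forall fun s => ?_)
  have := h (x + s • v) x w
  rw [add_sub_cancel_left, norm_smul] at this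
  simp only [zero_smul, add_zero, sub_zero]
  rw [Real.norm_eq_abs]
  calc _ ≤ _ := this
    _ = _ := by ring

/-- Fourth-order Taylor remainder for a Lipschitz third derivative. -/
lemma abs_taylor_le_of_lipschitz_third (hf : ContDiff ℝ 3 f) {L : ℝ}
    (h : ∀ y z w : V, |iteratedFDeriv ℝ 3 f y (fun _ => w) - iteratedFDeriv ℝ 3 f z (fun _ => w)| ≤
      L * ‖y - z‖ * ‖w‖ ^ 3) (x v : V) :
    |f (x + v) - f x - fderiv ℝ f x v - iteratedFDeriv ℝ 2 f x ![v, v] / 2 -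
      thirdDeriv f x v v v / 6| ≤ L * ‖v‖ ^ 4 / 24 := by
  have h0 : ∀ s : ℝ, HasDerivAt (fun s : ℝ => f (x + s • v))
      (iteratedFDeriv ℝ 1 f (x + s • v) ![v]) s := fun s => by
    have := hasDerivAt_iteratedFDeriv_line (k := 0) hf (by norm_num) x v ![] s
    simpa using this
  have h1 : ∀ s : ℝ, HasDerivAt (fun s : ℝ => iteratedFDeriv ℝ 1 f (x + s • v) ![v])
      (iteratedFDeriv ℝ 2 f (x + s • v) ![v, v]) s := fun s =>
    hasDerivAt_iteratedFDeriv_line hf (by norm_num) x v ![v] s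
  have key := abs_taylor_three_le h0 h1 (hasDerivAt_second_line hf x v v v)
    (M := L * ‖v‖ ^ 4) (fun s hs => by
      have := h (x + s • v) x v
      rw [add_sub_cancel_left, norm_smul, Real.norm_of_nonneg hs.1] at this
      simp only [iteratedFDeriv_three_const] at this
      simp only [zero_smul, add_zero]
      calc _ ≤ _ := this
        _ = _ := by ring)
  simpa using key

end HigherDerivatives

/-! ### Smoothness of the regularized loss. -/

section RegularizedLoss

open scoped RealInnerProductSpace

/-- A Lipschitz bound for the diagonal of the third derivative controls its mixed entries. -/
lemma abs_thirdDeriv_sub_le {V : Type*} [NormedAddCommGroup V] [InnerProductSpace ℝ V] {f : V → ℝ}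
    (hf : ContDiff ℝ 3 f) {L : ℝ}
    (h : ∀ y z w : V, |iteratedFDeriv ℝ 3 f y (fun _ => w) - iteratedFDeriv ℝ 3 f z (fun _ => w)| ≤
      L * ‖y - z‖ * ‖w‖ ^ 3) (y z v e : V) (he : ‖e‖ = 1) :
    |thirdDeriv f y v e e - thirdDeriv f z v e e| ≤ 73 / 54 * (L * ‖y - z‖) * ‖v‖ := by
  rcases eq_or_ne v 0 with rfl | hv
  · have h0 : ∀ x, thirdDeriv f x 0 e e = 0 := fun x => by
      simpa using thirdDeriv_smul (f := f) 0 x 0 e e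
    simp [h0]
  simp only [iteratedFDeriv_three_const] at h
  have hK : 0 ≤ L * ‖y - z‖ := by
    have := (abs_nonneg _).trans (h y z e)
    rwa [he, one_pow, mul_one] at this
  set K := L * ‖y - z‖
  have hv' : 0 < ‖v‖ := norm_pos_iff.2 hv
  set r := ‖v‖ with hr
  set t : ℝ := 3 / 2 * r with ht
  have hte : ‖t • e‖ = t := by rw [norm_smul, he, mul_one, Real.norm_of_nonneg (by positivity)]
  have e1 := thirdDeriv_polarization hf y v e t
  have e2 := thirdDeriv_polarization hf z v e t
  have b1 := abs_le.1 (h y z (v + t • e))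
  have b2 := abs_le.1 (h y z (v - t • e))
  have b3 := abs_le.1 (h y z v)
  have hp := parallelogram_law_with_norm ℝ v (t • e)
  have ha : ‖v + t • e‖ ≤ 5 / 2 * r := (norm_add_le _ _).trans (by rw [hte]; linarith)
  have hb : ‖v - t • e‖ ≤ 5 / 2 * r := (norm_sub_le _ _).trans (by rw [hte]; linarith)
  have na := norm_nonneg (v + t • e)
  have nb := norm_nonneg (v - t • e)
  rw [hte, ← hr] at hp
  set a := ‖v + t • e‖
  set b := ‖v - t • e‖
  have hab : a ^ 3 + b ^ 3 ≤ 65 / 4 * r ^ 3 := by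
    have h1 : a ^ 3 ≤ 5 / 2 * r * (a * a) := by nlinarith [mul_nonneg na na]
    have h2 : b ^ 3 ≤ 5 / 2 * r * (b * b) := by nlinarith [mul_nonneg nb nb]
    have h3 : 5 / 2 * r * (a * a) + 5 / 2 * r * (b * b) = 65 / 4 * r ^ 3 := by
      rw [← mul_add, ← sq, ← sq, hp, ht]; ring
    linarith
  have hab' : K * a ^ 3 + K * b ^ 3 + 2 * (K * r ^ 3) ≤ 73 / 4 * (K * r ^ 3) := by
    have := mul_le_mul_of_nonneg_left hab hK
    linarith
  have hD : |27 / 2 * r ^ 2 * (thirdDeriv f y v e e - thirdDeriv f z v e e)| ≤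
      73 / 4 * (K * r ^ 3) := by
    have e3 : 27 / 2 * r ^ 2 * (thirdDeriv f y v e e - thirdDeriv f z v e e) =
        6 * t ^ 2 * thirdDeriv f y v e e - 6 * t ^ 2 * thirdDeriv f z v e e := by
      rw [ht]; ring
    rw [e3, ← e1, ← e2, abs_le]
    constructor <;> linarith [b1.1, b1.2, b2.1, b2.2, b3.1, b3.2]
  rw [abs_mul, abs_of_pos (by positivity)] at hD
  have hr2 : 0 < 27 / 2 * r ^ 2 := by positivity
  refine le_of_mul_le_mul_left (hD.trans_eq ?_) hr2
  ring

variable {d : ℕ} {f : EuclideanSpace ℝ (Fin d) → ℝ}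

lemma trace_hessian (f : EuclideanSpace ℝ (Fin d) → ℝ) (x : EuclideanSpace ℝ (Fin d)) :
    (hessian f x).trace = ∑ i, iteratedFDeriv ℝ 2 f x
      ![EuclideanSpace.single i 1, EuclideanSpace.single i 1] := rfl

lemma contDiff_trace_hessian (hf : ContDiff ℝ 3 f) :
    ContDiff ℝ 1 fun x => (hessian f x).trace := by
  simp_rw [trace_hessian]
  refine ContDiff.sum fun i _ => ?_
  exact (ContinuousMultilinearMap.apply ℝ (fun _ : Fin 2 => EuclideanSpace ℝ (Fin d)) ℝ
    ![EuclideanSpace.single i 1, EuclideanSpace.single i 1]).contDiff.comp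
      (hf.iteratedFDeriv_right (i := 2) (m := 1) (by norm_num))

lemma inner_gradient_trace_hessian (hf : ContDiff ℝ 3 f) (x v : EuclideanSpace ℝ (Fin d)) :
    ⟪gradient (fun x => (hessian f x).trace) x, v⟫ = ∑ i, thirdDeriv f x v
      (EuclideanSpace.single i 1) (EuclideanSpace.single i 1) := by
  rw [inner_gradient_left]
  have h1 : HasDerivAt (fun s : ℝ => x + s • v) v 0 := by
    simpa using ((hasDerivAt_id (0 : ℝ)).smul_const v).const_add x
  have h2 : HasFDerivAt (fun x => (hessian f x).trace) (fderiv ℝ (fun x => (hessian f x).trace) x)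
      (x + (0 : ℝ) • v) := by
    rw [zero_smul, add_zero]
    exact ((contDiff_trace_hessian hf).differentiable (by simp) x).hasFDerivAt
  have h3 := h2.comp_hasDerivAt 0 h1
  have h4 : HasDerivAt (fun s : ℝ => (hessian f (x + s • v)).trace)
      (∑ i, thirdDeriv f (x + (0 : ℝ) • v) v
        (EuclideanSpace.single i 1) (EuclideanSpace.single i 1)) 0 := by
    simp_rw [trace_hessian]
    exact HasDerivAt.fun_sum fun i _ => hasDerivAt_second_line hf x v _ _ 0
  rw [zero_smul, add_zero] at h4
  exact h3.unique h4

/-- Test the gradient S against itself: each of the `d` entries [S, eᵢ, eᵢ] is at most L‖S‖. -/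
lemma norm_gradient_trace_hessian_le (hf : ContDiff ℝ 3 f) {L : ℝ} (hL : 0 ≤ L)
    (h : SecondOrderSmooth f L) (x : EuclideanSpace ℝ (Fin d)) :
    ‖gradient (fun x => (hessian f x).trace) x‖ ≤ d * L := by
  set S := gradient (fun x => (hessian f x).trace) x with hS
  have h1 : ‖S‖ * ‖S‖ ≤ (d * L) * ‖S‖ := by
    rw [← real_inner_self_eq_norm_mul_norm]
    nth_rewrite 1 [hS]
    rw [inner_gradient_trace_hessian hf]
    calc ∑ i, thirdDeriv f x S (EuclideanSpace.single i 1) (EuclideanSpace.single i 1)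
        ≤ ∑ i : Fin d, L * ‖S‖ := Finset.sum_le_sum fun i _ => by
          have := (le_abs_self _).trans (abs_thirdDeriv_le hf
            (abs_iteratedFDeriv_sub_le_of_unit two_ne_zero h) x S (EuclideanSpace.single i 1))
          simpa using this
      _ = (d * L) * ‖S‖ := by simp; ring
  rcases eq_or_lt_of_le (norm_nonneg S) with h0 | h0
  · rw [← h0]; positivity
  · exact le_of_mul_le_mul_right h1 h0

lemma abs_inner_gradient_trace_hessian_sub_le (hf : ContDiff ℝ 3 f) {L : ℝ}
    (h : ThirdOrderSmooth f L) (y z v : EuclideanSpace ℝ (Fin d)) :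
    |⟪gradient (fun x => (hessian f x).trace) y, v⟫ -
      ⟪gradient (fun x => (hessian f x).trace) z, v⟫| ≤
      d * (73 / 54 * (L * ‖y - z‖) * ‖v‖) := by
  rw [inner_gradient_trace_hessian hf, inner_gradient_trace_hessian hf, ← Finset.sum_sub_distrib]
  refine (Finset.abs_sum_le_sum_abs _ _).trans ?_
  calc _ ≤ ∑ i : Fin d, 73 / 54 * (L * ‖y - z‖) * ‖v‖ := Finset.sum_le_sum fun i _ =>
        abs_thirdDeriv_sub_le hf (abs_iteratedFDeriv_sub_le_of_unit three_ne_zero h) y z v _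
          (by simp)
    _ = _ := by simp

lemma contDiff_regLoss (hf : ContDiff ℝ 3 f) (lam : ℝ) : ContDiff ℝ 1 (regLoss f lam) :=
  (hf.of_le (by norm_num)).add (contDiff_const.mul (contDiff_trace_hessian hf))

lemma gradient_regLoss (hf : ContDiff ℝ 3 f) (lam : ℝ) (x : EuclideanSpace ℝ (Fin d)) :
    gradient (regLoss f lam) x =
      gradient f x + (lam ^ 2 / 2) • gradient (fun x => (hessian f x).trace) x := by
  have h1 := (hf.differentiable (by simp) x).hasGradientAt
  have h2 := ((contDiff_trace_hessian hf).differentiable (by simp) x).hasGradientAt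
  have h3 : HasFDerivAt (regLoss f lam) _ x :=
    h1.hasFDerivAt.add (h2.hasFDerivAt.const_mul (lam ^ 2 / 2))
  refine HasGradientAt.gradient ?_
  rw [hasGradientAt_iff_hasFDerivAt]
  refine h3.congr_fderiv ?_
  ext v
  simp

/-- The regularized loss is smooth along lines. -/
lemma regLoss_add_le (hf : ContDiff ℝ 3 f) {lam M : ℝ}
    (hM : ∀ y z v : EuclideanSpace ℝ (Fin d),
      |⟪gradient (regLoss f lam) y, v⟫ - ⟪gradient (regLoss f lam) z, v⟫| ≤ M * ‖y - z‖ * ‖v‖)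
    (x v : EuclideanSpace ℝ (Fin d)) :
    regLoss f lam (x + v) ≤ regLoss f lam x + ⟪gradient (regLoss f lam) x, v⟫ +
      M / 2 * ‖v‖ ^ 2 := by
  have h : ∀ s : ℝ, HasDerivAt (fun s : ℝ => regLoss f lam (x + s • v))
      ⟪gradient (regLoss f lam) (x + s • v), v⟫ s := fun s => by
    rw [inner_gradient_left]
    have h1 : HasDerivAt (fun s : ℝ => x + s • v) v s := by
      simpa using ((hasDerivAt_id s).smul_const v).const_add x
    exact ((contDiff_regLoss hf lam).differentiable (by simp) _).hasFDerivAt.comp_hasDerivAt s h1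
  have key := abs_sub_sub_le_of_lipschitz_deriv h (M := M * ‖v‖ ^ 2) (fun s hs => by
    have := hM (x + s • v) (x + (0 : ℝ) • v) v
    rw [zero_smul, add_zero, add_sub_cancel_left, norm_smul, Real.norm_of_nonneg hs.1] at this
    simp only [zero_smul, add_zero]
    calc _ ≤ _ := this
      _ = _ := by ring)
  simp only [one_smul, zero_smul, add_zero] at key
  linarith [(abs_le.1 key).2]

/-- A gradient step of length 1/M lowers F by at least ‖∇F‖²/(2M), and cannot go below the minimum.
-/
lemma sq_norm_gradient_regLoss_le (hf : ContDiff ℝ 3 f) {lam M : ℝ} (hMpos : 0 < M)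
    (hM : ∀ y z v : EuclideanSpace ℝ (Fin d),
      |⟪gradient (regLoss f lam) y, v⟫ - ⟪gradient (regLoss f lam) z, v⟫| ≤ M * ‖y - z‖ * ‖v‖)
    {xF : EuclideanSpace ℝ (Fin d)} (hxF : IsMinOn (regLoss f lam) Set.univ xF)
    (x : EuclideanSpace ℝ (Fin d)) :
    ‖gradient (regLoss f lam) x‖ ^ 2 ≤ 2 * M * (regLoss f lam x - regLoss f lam xF) := by
  set G := gradient (regLoss f lam) x with hG
  have h1 := regLoss_add_le hf hM x (-(M⁻¹ • G))
  have h2 : regLoss f lam xF ≤ regLoss f lam (x + -(M⁻¹ • G)) := hxF (Set.mem_univ _)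
  rw [← hG, inner_neg_right, real_inner_smul_right, real_inner_self_eq_norm_sq, norm_neg,
    norm_smul, Real.norm_of_nonneg (by positivity)] at h1
  have h3 : M / 2 * (M⁻¹ * ‖G‖) ^ 2 = M⁻¹ * ‖G‖ ^ 2 / 2 := by field_simp
  rw [h3] at h1
  have h4 : M⁻¹ * ‖G‖ ^ 2 ≤ 2 * (regLoss f lam x - regLoss f lam xF) := by linarith
  calc ‖G‖ ^ 2 = M * (M⁻¹ * ‖G‖ ^ 2) := by field_simp
    _ ≤ M * (2 * (regLoss f lam x - regLoss f lam xF)) := by gcongr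
    _ = _ := by ring

lemma regLoss_gradient_lipschitz (hd : 1 ≤ d) (hf : ContDiff ℝ 3 f) {L₁ L₃ lam : ℝ}
    (hL₁ : 0 < L₁) (hL₃ : 0 < L₃) (hf₁ : FirstOrderSmooth f L₁) (hf₃ : ThirdOrderSmooth f L₃)
    (hlam : lam ^ 2 ≤ √2 * L₁ / ((d : ℝ) ^ (3 / 2 : ℝ) * L₃))
    (y z v : EuclideanSpace ℝ (Fin d)) :
    |⟪gradient (regLoss f lam) y, v⟫ - ⟪gradient (regLoss f lam) z, v⟫| ≤
      2 * L₁ * ‖y - z‖ * ‖v‖ := by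
  have hd' : (1 : ℝ) ≤ d := by exact_mod_cast hd
  have hpow : (d : ℝ) ≤ (d : ℝ) ^ (3 / 2 : ℝ) := by
    conv_lhs => rw [← Real.rpow_one (d : ℝ)]
    exact Real.rpow_le_rpow_of_exponent_le hd' (by norm_num)
  -- A rational bound sharp enough that (71/50)(73/108) < 1, so the trace term adds at most one more
  -- `L₁`.
  have hsqrt : √2 ≤ 71 / 50 := Real.sqrt_le_iff.2 ⟨by norm_num, by norm_num⟩
  have hlam' : lam ^ 2 * (d * L₃) ≤ 71 / 50 * L₁ := by
    rw [le_div_iff₀ (by positivity)] at hlam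
    calc lam ^ 2 * (d * L₃) ≤ lam ^ 2 * ((d : ℝ) ^ (3 / 2 : ℝ) * L₃) := by gcongr
      _ ≤ √2 * L₁ := hlam
      _ ≤ _ := by gcongr
  have h1 : |⟪gradient f y, v⟫ - ⟪gradient f z, v⟫| ≤ L₁ * ‖y - z‖ * ‖v‖ := by
    rw [← inner_sub_left]
    exact (abs_real_inner_le_norm _ _).trans (by gcongr; exact hf₁ y z)
  have h2 := abs_inner_gradient_trace_hessian_sub_le hf hf₃ y z v
  rw [gradient_regLoss hf, gradient_regLoss hf, inner_add_left, inner_add_left,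
    real_inner_smul_left, real_inner_smul_left]
  have h3 : lam ^ 2 / 2 * (d * (73 / 54 * (L₃ * ‖y - z‖) * ‖v‖)) ≤ L₁ * ‖y - z‖ * ‖v‖ := by
    calc _ = lam ^ 2 * (d * L₃) * (73 / 108 * (‖y - z‖ * ‖v‖)) := by ring
      _ ≤ 71 / 50 * L₁ * (73 / 108 * (‖y - z‖ * ‖v‖)) := by gcongr
      _ = 71 * 73 / (50 * 108) * (L₁ * ‖y - z‖ * ‖v‖) := by ring
      _ ≤ 1 * (L₁ * ‖y - z‖ * ‖v‖) := by gcongr; norm_num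
      _ = _ := one_mul _
  set p := ⟪gradient (fun x => (hessian f x).trace) y, v⟫
  set q := ⟪gradient (fun x => (hessian f x).trace) z, v⟫
  have h4 : |lam ^ 2 / 2 * p - lam ^ 2 / 2 * q| ≤ L₁ * ‖y - z‖ * ‖v‖ := by
    rw [← mul_sub, abs_mul, abs_of_nonneg (by positivity)]
    exact (mul_le_mul_of_nonneg_left h2 (by positivity)).trans h3
  have h1' := abs_le.1 h1
  have h4' := abs_le.1 h4
  rw [abs_le]
  constructor <;> linarith [h1'.1, h1'.2, h4'.1, h4'.2]

end RegularizedLoss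

/-! ### Polynomial growth, which supplies Gaussian integrability. -/

section PolynomialGrowth

open scoped RealInnerProductSpace

variable {V : Type*} [NormedAddCommGroup V] [InnerProductSpace ℝ V]

/-- Continuous functions of at most polynomial growth. -/
def PolyBounded (φ : V → ℝ) : Prop :=
  Continuous φ ∧ ∃ (C : ℝ) (k : ℕ), ∀ u, |φ u| ≤ C * (1 + ‖u‖) ^ k

namespace PolyBounded

variable {φ ψ : V → ℝ}

lemma of_le {C : ℝ} {k : ℕ} (hφ : Continuous φ) (h : ∀ u, |φ u| ≤ C * (1 + ‖u‖) ^ k) :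
    PolyBounded φ := ⟨hφ, C, k, h⟩

lemma const (c : ℝ) : PolyBounded fun _ : V => c :=
  of_le continuous_const (C := |c|) (k := 0) fun u => by simp

lemma add (hφ : PolyBounded φ) (hψ : PolyBounded ψ) : PolyBounded fun u => φ u + ψ u := by
  obtain ⟨hφc, C, k, h⟩ := hφ
  obtain ⟨hψc, D, l, h'⟩ := hψ
  refine of_le (by fun_prop) (C := |C| + |D|) (k := k + l) fun u => ?_
  have h1 : (1 : ℝ) ≤ 1 + ‖u‖ := by linarith [norm_nonneg u]
  calc |φ u + ψ u| ≤ |φ u| + |ψ u| := abs_add_le _ _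
    _ ≤ |C| * (1 + ‖u‖) ^ k + |D| * (1 + ‖u‖) ^ l :=
      add_le_add ((h u).trans (by gcongr; exact le_abs_self C))
        ((h' u).trans (by gcongr; exact le_abs_self D))
    _ ≤ |C| * (1 + ‖u‖) ^ (k + l) + |D| * (1 + ‖u‖) ^ (k + l) := by gcongr <;> omega
    _ = _ := by ring

lemma mul (hφ : PolyBounded φ) (hψ : PolyBounded ψ) : PolyBounded fun u => φ u * ψ u := by
  obtain ⟨hφc, C, k, h⟩ := hφ
  obtain ⟨hψc, D, l, h'⟩ := hψ
  refine of_le (by fun_prop) (C := C * D) (k := k + l) fun u => ?_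
  rw [abs_mul]
  calc |φ u| * |ψ u| ≤ (C * (1 + ‖u‖) ^ k) * (D * (1 + ‖u‖) ^ l) :=
        mul_le_mul (h u) (h' u) (abs_nonneg _) ((abs_nonneg _).trans (h u))
    _ = _ := by ring

lemma const_mul (c : ℝ) (hφ : PolyBounded φ) : PolyBounded fun u => c * φ u := (const c).mul hφ

lemma sub (hφ : PolyBounded φ) (hψ : PolyBounded ψ) : PolyBounded fun u => φ u - ψ u := by
  simpa only [neg_one_mul, ← sub_eq_add_neg] using hφ.add (hψ.const_mul (-1))

lemma pow (hφ : PolyBounded φ) (n : ℕ) : PolyBounded fun u => φ u ^ n := by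
  induction n with
  | zero => simpa using const 1
  | succ n ih => simpa only [pow_succ] using ih.mul hφ

lemma norm : PolyBounded fun u : V => ‖u‖ :=
  of_le continuous_norm (C := 1) (k := 1) fun u => by
    rw [abs_of_nonneg (norm_nonneg u)]; linarith

lemma inner_left (w : V) : PolyBounded fun u : V => ⟪u, w⟫ :=
  of_le (by fun_prop) (C := ‖w‖) (k := 1) fun u => by
    refine (abs_real_inner_le_norm u w).trans ?_
    nlinarith [norm_nonneg u, norm_nonneg w]

lemma multilinear {k : ℕ} (A : ContinuousMultilinearMap ℝ (fun _ : Fin k => V) ℝ) :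
    PolyBounded fun u : V => A fun _ => u :=
  of_le (A.cont.comp (continuous_pi fun _ => continuous_id)) (C := ‖A‖) (k := k) fun u => by
    refine (A.le_opNorm_mul_pow_of_le (b := ‖u‖) (pi_norm_const_le u)).trans ?_
    gcongr
    linarith

lemma comp_add_smul (hφ : PolyBounded φ) (x : V) (c : ℝ) : PolyBounded fun u => φ (x + c • u) := by
  obtain ⟨hφc, C, k, h⟩ := hφ
  refine of_le (by fun_prop) (C := |C| * (1 + ‖x‖ + |c|) ^ k) (k := k) fun u => ?_
  have h1 : 1 + ‖x + c • u‖ ≤ (1 + ‖x‖ + |c|) * (1 + ‖u‖) := by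
    have := norm_add_le x (c • u)
    rw [norm_smul, Real.norm_eq_abs] at this
    nlinarith [norm_nonneg x, norm_nonneg u, abs_nonneg c,
      mul_nonneg (norm_nonneg x) (norm_nonneg u)]
  calc |φ (x + c • u)| ≤ C * (1 + ‖x + c • u‖) ^ k := h _
    _ ≤ |C| * ((1 + ‖x‖ + |c|) * (1 + ‖u‖)) ^ k := by gcongr; exact le_abs_self C
    _ = _ := by rw [mul_pow, mul_assoc]

lemma integrable [FiniteDimensional ℝ V] [MeasurableSpace V] [BorelSpace V] (hφ : PolyBounded φ) :
    Integrable φ (stdGaussian V) := by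
  obtain ⟨hφc, C, k, h⟩ := hφ
  exact integrable_stdGaussian_of_growth hφc.aestronglyMeasurable C k h

end PolyBounded

lemma integral_eq_zero_of_odd [FiniteDimensional ℝ V] [MeasurableSpace V] [BorelSpace V]
    {φ : V → ℝ} (h : ∀ u, φ (-u) = -φ u) : ∫ u, φ u ∂(stdGaussian V) = 0 := by
  have := integral_comp_neg_stdGaussian φ
  simp_rw [h, integral_neg] at this
  linarith

end PolynomialGrowth

/-! ### Convexity inequality and growth of `f`. -/

section Smoothing

open scoped RealInnerProductSpace

variable {d : ℕ} {f : EuclideanSpace ℝ (Fin d) → ℝ}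

/-- Restrict to the segment from `y` to `z` and compare the slope with the derivative at `y`. -/
lemma ConvexOn.sub_le_fderiv {V : Type*} [NormedAddCommGroup V] [NormedSpace ℝ V] {f : V → ℝ}
    (hconv : ConvexOn ℝ Set.univ f) (hf : Differentiable ℝ f) (y z : V) :
    f y - f z ≤ fderiv ℝ f y (y - z) := by
  have hc : ConvexOn ℝ Set.univ (fun s : ℝ => f (AffineMap.lineMap y z s)) :=
    hconv.comp_affineMap (AffineMap.lineMap y z)
  have hd : HasDerivAt (fun s : ℝ => f (AffineMap.lineMap y z s)) (fderiv ℝ f y (z - y)) 0 := by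
    have h1 : HasDerivAt (AffineMap.lineMap y z : ℝ → V) (z - y) 0 := AffineMap.hasDerivAt_lineMap
    have h2 : HasFDerivAt f (fderiv ℝ f y) ((AffineMap.lineMap y z : ℝ → V) 0) := by
      rw [AffineMap.lineMap_apply_zero]; exact (hf y).hasFDerivAt
    exact h2.comp_hasDerivAt 0 h1
  have := hc.le_slope_of_hasDerivAt (Set.mem_univ 0) (Set.mem_univ 1) zero_lt_one hd
  rw [slope_def_field] at this
  simp only [AffineMap.lineMap_apply_one, AffineMap.lineMap_apply_zero, sub_zero, div_one] at this
  rw [← neg_sub z y, map_neg]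
  linarith

lemma polyBounded_fderiv (hf : ContDiff ℝ 3 f) {L : ℝ} (hL : 0 < L) (hf₁ : FirstOrderSmooth f L)
    (w : EuclideanSpace ℝ (Fin d)) : PolyBounded fun u => fderiv ℝ f u w := by
  refine PolyBounded.of_le ((hf.continuous_fderiv (by simp)).clm_apply continuous_const)
    (C := (‖gradient f 0‖ + L) * ‖w‖) (k := 1) fun u => ?_
  rw [← inner_gradient_left]
  refine (abs_real_inner_le_norm _ _).trans ?_
  have h1 : ‖gradient f u‖ ≤ ‖gradient f 0‖ + L * ‖u‖ := by
    have h2 := hf₁ u 0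
    rw [sub_zero] at h2
    have h3 := norm_add_le (gradient f 0) (gradient f u - gradient f 0)
    rw [add_sub_cancel] at h3
    linarith
  have h4 : ‖gradient f u‖ ≤ (‖gradient f 0‖ + L) * (1 + ‖u‖) := by
    nlinarith [norm_nonneg u, norm_nonneg (gradient f 0),
      mul_nonneg (norm_nonneg u) (norm_nonneg (gradient f 0))]
  calc _ ≤ ((‖gradient f 0‖ + L) * (1 + ‖u‖)) * ‖w‖ := by gcongr
    _ = _ := by ring

/-- `f` differs from its cubic Taylor polynomial at 0 by at most a quartic. -/
lemma polyBounded_of_thirdOrderSmooth (hf : ContDiff ℝ 3 f) {L : ℝ} (hf₃ : ThirdOrderSmooth f L) :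
    PolyBounded f := by
  have hT := abs_taylor_le_of_lipschitz_third hf
    (abs_iteratedFDeriv_sub_le_of_unit three_ne_zero hf₃) 0
  have h1 : PolyBounded fun u => fderiv ℝ f 0 u := by
    simp_rw [← inner_gradient_left, real_inner_comm]
    exact PolyBounded.inner_left _
  have h2 : PolyBounded fun u => iteratedFDeriv ℝ 2 f 0 ![u, u] := by
    simp_rw [← const_eq_vecCons_two]
    exact PolyBounded.multilinear _
  have h3 : PolyBounded fun u => thirdDeriv f 0 u u u := by
    simp_rw [← iteratedFDeriv_three_const]
    exact PolyBounded.multilinear _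
  have hf0 : Continuous f := hf.continuous
  have hc : PolyBounded fun u => f u - f 0 - fderiv ℝ f 0 u - iteratedFDeriv ℝ 2 f 0 ![u, u] / 2 -
      thirdDeriv f 0 u u u / 6 := by
    refine PolyBounded.of_le (C := |L| / 24) (k := 4) ?_ fun u => ?_
    · have := h1.1; have := h2.1; have := h3.1
      fun_prop
    · have := hT u
      rw [zero_add] at this
      refine this.trans ?_
      calc L * ‖u‖ ^ 4 / 24 = L / 24 * ‖u‖ ^ 4 := by ring
        _ ≤ |L| / 24 * (1 + ‖u‖) ^ 4 := by
          gcongr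
          · exact le_abs_self L
          · linarith [norm_nonneg u]
  have := (((hc.add (h3.const_mul (1 / 6))).add (h2.const_mul (1 / 2))).add h1).add
    (PolyBounded.const (f 0))
  convert this using 2
  ring

end Smoothing

/-! ### Bias and pointwise size of the two-point estimator. -/

section TwoPointEstimator

open scoped RealInnerProductSpace

variable {d : ℕ} {f : EuclideanSpace ℝ (Fin d) → ℝ}

/-- Expand one copy of `u` in coordinates and use E⟨u, v⟩⟨u, w⟩ = ⟨v, w⟩, with `b i` the Riesz
vector of ∇²f(x)[eᵢ, ·]. -/
lemma integral_second_derivative_stdGaussian (f : EuclideanSpace ℝ (Fin d) → ℝ)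
    (x : EuclideanSpace ℝ (Fin d)) :
    ∫ u, iteratedFDeriv ℝ 2 f x ![u, u] ∂(stdGaussian (EuclideanSpace ℝ (Fin d))) =
      (hessian f x).trace := by
  set A : EuclideanSpace ℝ (Fin d) →L[ℝ] EuclideanSpace ℝ (Fin d) →L[ℝ] ℝ :=
    fderiv ℝ (fderiv ℝ f) x with hA
  let b : Fin d → EuclideanSpace ℝ (Fin d) := fun i =>
    (InnerProductSpace.toDual ℝ _).symm (A (EuclideanSpace.single i 1))
  have hb : ∀ i v, ⟪b i, v⟫ = A (EuclideanSpace.single i 1) v := fun i v =>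
    InnerProductSpace.toDual_symm_apply
  have h1 : ∀ u, iteratedFDeriv ℝ 2 f x ![u, u] =
      ∑ i, ⟪u, EuclideanSpace.single i 1⟫ * ⟪u, b i⟫ := by
    intro u
    rw [iteratedFDeriv_two_apply]
    have hu : u = ∑ i, ⟪u, EuclideanSpace.single i (1 : ℝ)⟫ • EuclideanSpace.single i (1 : ℝ) := by
      have := (EuclideanSpace.basisFun (Fin d) ℝ).sum_repr' u
      simpa [EuclideanSpace.basisFun_apply, real_inner_comm] using this.symm
    have hA' : ∀ w, A u w =
        ∑ i, ⟪u, EuclideanSpace.single i (1 : ℝ)⟫ * A (EuclideanSpace.single i 1) w := by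
      intro w
      have := congrArg (fun v => A v w) hu
      simpa [map_sum] using this
    change A u u = _
    rw [hA' u]
    refine Finset.sum_congr rfl fun i _ => ?_
    rw [real_inner_comm (b i) u, hb]
  simp_rw [h1]
  rw [integral_finsetSum _ fun i _ =>
    ((PolyBounded.inner_left _).mul (PolyBounded.inner_left _)).integrable]
  simp_rw [integral_inner_mul_inner_stdGaussian, trace_hessian]
  refine Finset.sum_congr rfl fun i _ => ?_
  rw [real_inner_comm, hb, iteratedFDeriv_two_apply]
  rfl

lemma abs_taylor_smul_le (hf : ContDiff ℝ 3 f) {L : ℝ} (hf₃ : ThirdOrderSmooth f L) (lam : ℝ)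
    (x u : EuclideanSpace ℝ (Fin d)) :
    |f (x + lam • u) - f x - lam * fderiv ℝ f x u - lam ^ 2 / 2 * iteratedFDeriv ℝ 2 f x ![u, u] -
      lam ^ 3 / 6 * thirdDeriv f x u u u| ≤ L * lam ^ 4 / 24 * ‖u‖ ^ 4 := by
  have h := abs_taylor_le_of_lipschitz_third hf
    (abs_iteratedFDeriv_sub_le_of_unit three_ne_zero hf₃) x (lam • u)
  have h2 : iteratedFDeriv ℝ 2 f x ![lam • u, lam • u] =
      lam ^ 2 * iteratedFDeriv ℝ 2 f x ![u, u] := by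
    simp only [← const_eq_vecCons_two]
    exact iteratedFDeriv_const_smul x u lam
  have h3 : thirdDeriv f x (lam • u) (lam • u) (lam • u) = lam ^ 3 * thirdDeriv f x u u u := by
    simp only [← iteratedFDeriv_three_const]
    exact iteratedFDeriv_const_smul x u lam
  rw [h2, h3, map_smul, smul_eq_mul, norm_smul, mul_pow, Real.norm_eq_abs] at h
  rw [show |lam| ^ 4 = lam ^ 4 from Even.pow_abs (by decide) lam] at h
  convert h using 1
  · congr 1; ring
  · ring

/-- Gaussian smoothing agrees with the regularized loss up to fourth order. -/
lemma abs_smoothing_sub_regLoss_le (hf : ContDiff ℝ 3 f) {L : ℝ} (hf₃ : ThirdOrderSmooth f L)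
    (lam : ℝ) (x : EuclideanSpace ℝ (Fin d)) :
    |∫ u, f (x + lam • u) ∂(stdGaussian (EuclideanSpace ℝ (Fin d))) - regLoss f lam x| ≤
      L * lam ^ 4 / 24 * (d * (d + 2)) := by
  have i0 := ((polyBounded_of_thirdOrderSmooth hf hf₃).comp_add_smul x lam)
  have i1 : PolyBounded fun u => fderiv ℝ f x u := by
    simp_rw [← inner_gradient_left, real_inner_comm]
    exact PolyBounded.inner_left _
  have i2 : PolyBounded fun u => iteratedFDeriv ℝ 2 f x ![u, u] := by
    simp_rw [← const_eq_vecCons_two]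
    exact PolyBounded.multilinear _
  have i3 : PolyBounded fun u => thirdDeriv f x u u u := by
    simp_rw [← iteratedFDeriv_three_const]
    exact PolyBounded.multilinear _
  have o1 : ∫ u, fderiv ℝ f x u ∂(stdGaussian (EuclideanSpace ℝ (Fin d))) = 0 :=
    integral_eq_zero_of_odd fun u => map_neg _ _
  have o3 : ∫ u, thirdDeriv f x u u u ∂(stdGaussian (EuclideanSpace ℝ (Fin d))) = 0 := by
    refine integral_eq_zero_of_odd fun u => ?_
    have := iteratedFDeriv_const_smul (f := f) (k := 3) x u (-1)
    simp only [iteratedFDeriv_three_const, neg_one_smul] at this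
    rw [this]; ring
  have hT : ∫ u, (f (x + lam • u) - f x - lam * fderiv ℝ f x u -
      lam ^ 2 / 2 * iteratedFDeriv ℝ 2 f x ![u, u] - lam ^ 3 / 6 * thirdDeriv f x u u u)
      ∂(stdGaussian (EuclideanSpace ℝ (Fin d))) =
      ∫ u, f (x + lam • u) ∂(stdGaussian (EuclideanSpace ℝ (Fin d))) - regLoss f lam x := by
    rw [integral_sub ((((i0.sub (.const _)).sub (i1.const_mul _)).sub (i2.const_mul _)).integrable)
      (i3.const_mul _).integrable, integral_sub (((i0.sub (.const _)).sub
      (i1.const_mul _)).integrable) (i2.const_mul _).integrable, integral_sub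
      (i0.sub (.const _)).integrable (i1.const_mul _).integrable,
      integral_sub i0.integrable (PolyBounded.const _).integrable, integral_const_mul,
      integral_const_mul, integral_const_mul, o1, o3, integral_second_derivative_stdGaussian,
      regLoss]
    simp
    ring
  rw [← hT, ← Real.norm_eq_abs]
  have h4 : ∫ u, L * lam ^ 4 / 24 * ‖u‖ ^ 4 ∂(stdGaussian (EuclideanSpace ℝ (Fin d))) =
      L * lam ^ 4 / 24 * (d * (d + 2)) := by
    have := integral_norm_sq_pow_stdGaussian (V := EuclideanSpace ℝ (Fin d)) 2
    simp_rw [← pow_mul] at this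
    rw [integral_const_mul, this]
    simp [Finset.prod_range_succ]
  rw [← h4]
  exact norm_integral_le_of_norm_le ((PolyBounded.norm.pow 4).const_mul _).integrable
    (.of_forall fun u => abs_taylor_smul_le hf hf₃ lam x u)

/-- The two-point estimator is unbiased for the gradient of the Gaussian smoothing. -/
lemma integral_inner_twoPoint (hf : ContDiff ℝ 3 f) {L₁ L₃ : ℝ} (hL₁ : 0 < L₁)
    (hf₁ : FirstOrderSmooth f L₁) (hf₃ : ThirdOrderSmooth f L₃) {lam : ℝ} (hlam : 0 < lam)
    (x w : EuclideanSpace ℝ (Fin d)) :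
    ∫ u, ⟪twoPoint f lam x u, w⟫ ∂(stdGaussian (EuclideanSpace ℝ (Fin d))) =
      ∫ u, fderiv ℝ f (x + lam • u) w ∂(stdGaussian (EuclideanSpace ℝ (Fin d))) := by
  have i0 := polyBounded_of_thirdOrderSmooth hf hf₃
  have ip := ((i0.comp_add_smul x lam).mul (.inner_left w)).integrable
  have im := ((i0.comp_add_smul x (-lam)).mul (.inner_left w)).integrable
  have hd : ∀ u, fderiv ℝ (fun u => f (x + lam • u)) u w = lam * fderiv ℝ f (x + lam • u) w := by
    intro u
    have h1 : HasFDerivAt (fun u : EuclideanSpace ℝ (Fin d) => x + lam • u)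
        (lam • ContinuousLinearMap.id ℝ _) u := ((hasFDerivAt_id u).const_smul lam).const_add x
    have h2 := ((hf.differentiable (by simp) (x + lam • u)).hasFDerivAt).comp u h1
    have h3 := h2.fderiv
    simp only [Function.comp_def] at h3
    rw [h3]
    simp
  have hS := integral_fderiv_stdGaussian (φ := fun u => f (x + lam • u))
    ((hf.differentiable (by simp)).comp (by fun_prop)) w (i0.comp_add_smul x lam).integrable
    (by
      simp_rw [hd]
      exact (((polyBounded_fderiv hf hL₁ hf₁ w).comp_add_smul x lam).const_mul lam).integrable) ip
  simp_rw [hd, integral_const_mul] at hS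
  -- The reflection u ↦ -u makes the backward evaluation contribute as much as the forward one.
  have hneg : ∫ u, f (x + (-lam) • u) * ⟪u, w⟫ ∂(stdGaussian (EuclideanSpace ℝ (Fin d))) =
      -∫ u, f (x + lam • u) * ⟪u, w⟫ ∂(stdGaussian (EuclideanSpace ℝ (Fin d))) := by
    rw [← integral_comp_neg_stdGaussian, ← integral_neg]
    simp
  have he : ∀ u, ⟪twoPoint f lam x u, w⟫ =
      (2 * lam)⁻¹ * (f (x + lam • u) * ⟪u, w⟫ - f (x + (-lam) • u) * ⟪u, w⟫) := by
    intro u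
    rw [twoPoint, real_inner_smul_left, neg_smul, ← sub_eq_add_neg]
    ring
  simp_rw [he]
  rw [integral_const_mul, integral_sub ip im, hneg, ← hS]
  field_simp
  ring

/-- Average the gradient inequality of `f` between x + λu and z + λu; the common shift cancels in
the difference. -/
lemma smoothing_sub_le_integral_inner_twoPoint (hf : ContDiff ℝ 3 f) {L₁ L₃ : ℝ} (hL₁ : 0 < L₁)
    (hf₁ : FirstOrderSmooth f L₁) (hf₃ : ThirdOrderSmooth f L₃) (hconv : ConvexOn ℝ Set.univ f)
    {lam : ℝ} (hlam : 0 < lam) (x z : EuclideanSpace ℝ (Fin d)) :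
    ∫ u, f (x + lam • u) ∂(stdGaussian (EuclideanSpace ℝ (Fin d))) -
        ∫ u, f (z + lam • u) ∂(stdGaussian (EuclideanSpace ℝ (Fin d))) ≤
      ∫ u, ⟪twoPoint f lam x u, x - z⟫ ∂(stdGaussian (EuclideanSpace ℝ (Fin d))) := by
  have i0 := polyBounded_of_thirdOrderSmooth hf hf₃
  rw [integral_inner_twoPoint hf hL₁ hf₁ hf₃ hlam,
    ← integral_sub (i0.comp_add_smul x lam).integrable (i0.comp_add_smul z lam).integrable]
  refine integral_mono
    ((i0.comp_add_smul x lam).sub (i0.comp_add_smul z lam)).integrable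
    ((polyBounded_fderiv hf hL₁ hf₁ (x - z)).comp_add_smul x lam).integrable fun u => ?_
  have := ConvexOn.sub_le_fderiv hconv (hf.differentiable (by simp)) (x + lam • u) (z + lam • u)
  rwa [add_sub_add_right_eq_sub] at this

lemma sq_norm_twoPoint_le (hf : ContDiff ℝ 3 f) {L₂ L₃ : ℝ}
    (hf₂ : SecondOrderSmooth f L₂) (hf₃ : ThirdOrderSmooth f L₃) {lam : ℝ} (hlam : 0 < lam)
    (x u : EuclideanSpace ℝ (Fin d)) :
    ‖twoPoint f lam x u‖ ^ 2 ≤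
      2 * (⟪u, gradient (regLoss f lam) x⟫ ^ 2 * ‖u‖ ^ 2) +
      2 / 9 * lam ^ 4 * L₂ ^ 2 * (‖u‖ ^ 2) ^ 4 +
      2 * lam ^ 4 * (⟪u, gradient (fun x => (hessian f x).trace) x⟫ ^ 2 * ‖u‖ ^ 2) +
      L₃ ^ 2 * lam ^ 6 / 144 * (‖u‖ ^ 2) ^ 5 := by
  set h := (f (x + lam • u) - f (x - lam • u)) / (2 * lam) with hh
  set p := ⟪u, gradient (regLoss f lam) x⟫ with hp
  set q := ⟪u, gradient (fun x => (hessian f x).trace) x⟫ with hq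
  set t := thirdDeriv f x u u u with ht
  have hg : ⟪u, gradient f x⟫ = p - lam ^ 2 / 2 * q := by
    rw [hp, hq, gradient_regLoss hf, inner_add_right, real_inner_smul_right]; ring
  have hg' : fderiv ℝ f x u = p - lam ^ 2 / 2 * q := by
    rw [← hg, real_inner_comm, inner_gradient_left]
  have ht' : |t| ≤ L₂ * ‖u‖ ^ 3 := by
    have := abs_thirdDeriv_le hf (abs_iteratedFDeriv_sub_le_of_unit two_ne_zero hf₂) x u u
    calc |t| ≤ _ := this
      _ = _ := by ring
  have hr : |h - (p - lam ^ 2 / 2 * q) - lam ^ 2 / 6 * t| ≤ L₃ * lam ^ 3 / 24 * ‖u‖ ^ 4 := by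
    have h1 := abs_taylor_smul_le hf hf₃ lam x u
    have h2 := abs_taylor_smul_le hf hf₃ (-lam) x u
    rw [hg'] at h1 h2
    rw [neg_smul, ← sub_eq_add_neg] at h2
    -- The quadratic term is even in `lam` and drops out of the symmetric difference.
    set D := iteratedFDeriv ℝ 2 f x ![u, u]
    have e : h - (p - lam ^ 2 / 2 * q) - lam ^ 2 / 6 * t = (2 * lam)⁻¹ *
        ((f (x + lam • u) - f x - lam * (p - lam ^ 2 / 2 * q) - lam ^ 2 / 2 * D -
          lam ^ 3 / 6 * t) - (f (x - lam • u) - f x - -lam * (p - lam ^ 2 / 2 * q) -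
          (-lam) ^ 2 / 2 * D - (-lam) ^ 3 / 6 * t)) := by
      rw [hh]; field_simp; ring
    rw [e, abs_mul, abs_of_pos (by positivity)]
    calc _ ≤ (2 * lam)⁻¹ * (L₃ * lam ^ 4 / 24 * ‖u‖ ^ 4 + L₃ * (-lam) ^ 4 / 24 * ‖u‖ ^ 4) := by
          gcongr
          exact (abs_sub _ _).trans (add_le_add h1 h2)
      _ = _ := by field_simp; ring
  have hn : ‖twoPoint f lam x u‖ ^ 2 = h ^ 2 * ‖u‖ ^ 2 := by
    rw [twoPoint, norm_smul, mul_pow, Real.norm_eq_abs, sq_abs]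
  set r := h - (p - lam ^ 2 / 2 * q) - lam ^ 2 / 6 * t with hrdef
  have hr2 : r ^ 2 ≤ (L₃ * lam ^ 3 / 24 * ‖u‖ ^ 4) ^ 2 := by
    rw [← sq_abs r]; gcongr
  have ht2 : t ^ 2 ≤ (L₂ * ‖u‖ ^ 3) ^ 2 := by
    rw [← sq_abs t]; gcongr
  -- Repeated (a+b)² ≤ 2a² + 2b², splitting off `p` first, then `r`: weights 2 and 4, and 8 for each
  -- of the two λ² terms. The main term keeps its factor 2.
  have hsq : h ^ 2 ≤ 2 * p ^ 2 + 2 / 9 * lam ^ 4 * t ^ 2 + 2 * lam ^ 4 * q ^ 2 + 4 * r ^ 2 := by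
    have e : h = p + lam ^ 2 / 6 * t - lam ^ 2 / 2 * q + r := by rw [hrdef]; ring
    rw [e]
    nlinarith [sq_nonneg (p - (lam ^ 2 / 6 * t - lam ^ 2 / 2 * q + r)),
      sq_nonneg (lam ^ 2 / 6 * t - lam ^ 2 / 2 * q - r),
      sq_nonneg (lam ^ 2 / 6 * t + lam ^ 2 / 2 * q)]
  rw [hn]
  calc h ^ 2 * ‖u‖ ^ 2 ≤ (2 * p ^ 2 + 2 / 9 * lam ^ 4 * (L₂ * ‖u‖ ^ 3) ^ 2 +
        2 * lam ^ 4 * q ^ 2 + 4 * (L₃ * lam ^ 3 / 24 * ‖u‖ ^ 4) ^ 2) * ‖u‖ ^ 2 := by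
        refine mul_le_mul_of_nonneg_right (hsq.trans ?_) (by positivity)
        gcongr
    _ = _ := by ring

end TwoPointEstimator

/-! ### Second moment and one-step drift. -/

section OneStep

open scoped RealInnerProductSpace

variable {d : ℕ} {f : EuclideanSpace ℝ (Fin d) → ℝ}

lemma continuous_twoPoint (hf : Continuous f) (lam : ℝ) :
    Continuous fun p : EuclideanSpace ℝ (Fin d) × EuclideanSpace ℝ (Fin d) =>
      twoPoint f lam p.1 p.2 := by
  unfold twoPoint
  fun_prop

lemma polyBounded_inner_twoPoint (hf : PolyBounded f) (lam : ℝ) (x w : EuclideanSpace ℝ (Fin d)) :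
    PolyBounded fun u => ⟪twoPoint f lam x u, w⟫ := by
  have := (((hf.comp_add_smul x lam).sub (hf.comp_add_smul x (-lam))).const_mul (2 * lam)⁻¹).mul
    (.inner_left w)
  convert this using 2 with u
  rw [twoPoint, real_inner_smul_left, neg_smul, ← sub_eq_add_neg]
  ring

lemma polyBounded_sq_norm_twoPoint (hf : PolyBounded f) (lam : ℝ)
    (x : EuclideanSpace ℝ (Fin d)) : PolyBounded fun u => ‖twoPoint f lam x u‖ ^ 2 := by
  have := ((((hf.comp_add_smul x lam).sub (hf.comp_add_smul x (-lam))).const_mul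
    (2 * lam)⁻¹).pow 2).mul (PolyBounded.norm.pow 2)
  convert this using 2 with u
  rw [twoPoint, norm_smul, mul_pow, Real.norm_eq_abs, sq_abs, neg_smul, ← sub_eq_add_neg]
  ring

/-- Second moment of the two-point estimator. -/
lemma integral_sq_norm_twoPoint_le (hf : ContDiff ℝ 3 f) {L₂ L₃ : ℝ} (hL₂ : 0 ≤ L₂)
    (hf₂ : SecondOrderSmooth f L₂) (hf₃ : ThirdOrderSmooth f L₃) {lam : ℝ} (hlam : 0 < lam)
    (x : EuclideanSpace ℝ (Fin d)) :
    ∫ u, ‖twoPoint f lam x u‖ ^ 2 ∂(stdGaussian (EuclideanSpace ℝ (Fin d))) ≤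
      2 * (d + 2) * ‖gradient (regLoss f lam) x‖ ^ 2 +
        L₂ ^ 2 * lam ^ 4 * (((d : ℝ) + 6) ^ 4 / 3) +
        L₃ ^ 2 * lam ^ 6 / 144 * (((d : ℝ) + 6) * ((d : ℝ) + 10) ^ 4) := by
  have i0 := polyBounded_of_thirdOrderSmooth hf hf₃
  have j1 : ∀ v : EuclideanSpace ℝ (Fin d), PolyBounded fun u => ⟪u, v⟫ ^ 2 * ‖u‖ ^ 2 :=
    fun v => ((PolyBounded.inner_left v).pow 2).mul (PolyBounded.norm.pow 2)
  have j2 : ∀ k, PolyBounded fun u : EuclideanSpace ℝ (Fin d) => (‖u‖ ^ 2) ^ k :=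
    fun k => (PolyBounded.norm.pow 2).pow k
  have hb := integral_mono (polyBounded_sq_norm_twoPoint i0 lam x).integrable
    (((((j1 _).const_mul _).add ((j2 4).const_mul _)).add ((j1 _).const_mul _)).add
      ((j2 5).const_mul _)).integrable (fun u => sq_norm_twoPoint_le hf hf₂ hf₃ hlam x u)
  refine hb.trans ?_
  rw [integral_add ((((j1 _).const_mul _).add ((j2 4).const_mul _)).add
      ((j1 _).const_mul _)).integrable ((j2 5).const_mul _).integrable,
    integral_add (((j1 _).const_mul _).add ((j2 4).const_mul _)).integrable
      ((j1 _).const_mul _).integrable,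
    integral_add ((j1 _).const_mul _).integrable ((j2 4).const_mul _).integrable]
  simp only [integral_const_mul, integral_sq_inner_mul_norm_sq_stdGaussian,
    integral_norm_sq_pow_stdGaussian, finrank_euclideanSpace_fin, Finset.prod_range_succ,
    Finset.prod_range_zero]
  push_cast
  have hS := norm_gradient_trace_hessian_le hf hL₂ hf₂ x
  have hS2 : ‖gradient (fun x => (hessian f x).trace) x‖ ^ 2 ≤ (d * L₂) ^ 2 := by gcongr
  have hd : (0 : ℝ) ≤ d := Nat.cast_nonneg d
  set n : ℝ := (Nat.cast d : ℝ)
  have e1 : 2 * lam ^ 4 * ((n + 2) * ‖gradient (fun x => (hessian f x).trace) x‖ ^ 2) ≤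
      2 * lam ^ 4 * ((n + 2) * (n * L₂) ^ 2) := by gcongr
  -- Merges the two L₂²λ⁴ contributions. A factor n + 6 is kept here and in `e3` for `η` to cancel
  -- later.
  have e2 : 2 / 9 * (n * (n + 2) * (n + 4) * (n + 6)) + 2 * ((n + 2) * n ^ 2) ≤
      (n + 6) ^ 4 / 3 := by
    have : 0 ≤ n ^ 4 := by positivity
    have : 0 ≤ n ^ 3 := by positivity
    have : 0 ≤ n ^ 2 := by positivity
    nlinarith
  have e3 : n * (n + 2) * (n + 4) * (n + 6) * (n + 8) ≤ (n + 6) * (n + 10) ^ 4 := by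
    have : n * (n + 2) * (n + 4) * (n + 8) ≤ (n + 10) * (n + 10) * (n + 10) * (n + 10) := by
      gcongr <;> linarith
    calc _ = (n + 6) * (n * (n + 2) * (n + 4) * (n + 8)) := by ring
      _ ≤ (n + 6) * ((n + 10) * (n + 10) * (n + 10) * (n + 10)) := by gcongr
      _ = _ := by ring
  have e2' := mul_le_mul_of_nonneg_left e2 (show 0 ≤ L₂ ^ 2 * lam ^ 4 by positivity)
  have e3' := mul_le_mul_of_nonneg_left e3 (show 0 ≤ L₃ ^ 2 * lam ^ 6 / 144 by positivity)
  calc _ = 2 * (n + 2) * ‖gradient (regLoss f lam) x‖ ^ 2 +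
        (2 / 9 * lam ^ 4 * L₂ ^ 2 * (n * (n + 2) * (n + 4) * (n + 6)) +
        2 * lam ^ 4 * ((n + 2) * ‖gradient (fun x => (hessian f x).trace) x‖ ^ 2)) +
        L₃ ^ 2 * lam ^ 6 / 144 * (n * (n + 2) * (n + 4) * (n + 6) * (n + 8)) := by ring
    _ ≤ _ := by
      gcongr
      refine le_trans ?_ e2'
      refine (add_le_add_right e1 _).trans_eq ?_
      ring

/-- Expected decrease of the squared distance to a minimizer in one step. -/
lemma integral_sq_dist_step_le (hd : 1 ≤ d) {L₁ L₂ L₃ : ℝ}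
    (hL₁ : 0 < L₁) (hL₂ : 0 < L₂) (hL₃ : 0 < L₃)
    (hf : ContDiff ℝ 3 f)
    (hf₁ : FirstOrderSmooth f L₁) (hf₂ : SecondOrderSmooth f L₂) (hf₃ : ThirdOrderSmooth f L₃)
    (hconv : ConvexOn ℝ Set.univ f)
    {η lam : ℝ} (hη : η = 1 / (8 * ((d : ℝ) + 6) * L₁)) (hlam : 0 < lam)
    (hlam' : lam ^ 2 ≤ √2 * L₁ / ((d : ℝ) ^ (3 / 2 : ℝ) * L₃))
    {xF : EuclideanSpace ℝ (Fin d)} (hxF : IsMinOn (regLoss f lam) Set.univ xF)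
    (x : EuclideanSpace ℝ (Fin d)) :
    Integrable (fun u => ‖x - η • twoPoint f lam x u - xF‖ ^ 2)
        (stdGaussian (EuclideanSpace ℝ (Fin d))) ∧
      ∫ u, ‖x - η • twoPoint f lam x u - xF‖ ^ 2 ∂(stdGaussian (EuclideanSpace ℝ (Fin d))) +
        η * (regLoss f lam x - regLoss f lam xF) ≤ ‖x - xF‖ ^ 2 +
      η * (L₃ / 6 * lam ^ 4 * ((d : ℝ) + 4) ^ 2
          + L₂ ^ 2 / (24 * L₁) * lam ^ 4 * ((d : ℝ) + 6) ^ 3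
          + L₃ ^ 2 / (1152 * L₁) * lam ^ 6 * ((d : ℝ) + 10) ^ 4) := by
  have i0 := polyBounded_of_thirdOrderSmooth hf hf₃
  have hn : (0 : ℝ) ≤ d := Nat.cast_nonneg d
  have hηpos : 0 < η := by rw [hη]; positivity
  have he : ∀ u, ‖x - η • twoPoint f lam x u - xF‖ ^ 2 = ‖x - xF‖ ^ 2 -
      2 * η * ⟪twoPoint f lam x u, x - xF⟫ + η ^ 2 * ‖twoPoint f lam x u‖ ^ 2 := by
    intro u
    rw [sub_right_comm, norm_sub_sq_real, real_inner_smul_right, norm_smul, mul_pow,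
      Real.norm_eq_abs, sq_abs, real_inner_comm]
    ring
  have p1 := (polyBounded_inner_twoPoint i0 lam x (x - xF)).const_mul (2 * η)
  have p2 := (polyBounded_sq_norm_twoPoint i0 lam x).const_mul (η ^ 2)
  have p0 : PolyBounded fun _ : EuclideanSpace ℝ (Fin d) => ‖x - xF‖ ^ 2 := .const _
  simp_rw [he]
  refine ⟨((p0.sub p1).add p2).integrable, ?_⟩
  rw [integral_add (p0.sub p1).integrable p2.integrable, integral_sub p0.integrable p1.integrable,
    integral_const_mul, integral_const_mul]
  have a1 := smoothing_sub_le_integral_inner_twoPoint hf hL₁ hf₁ hf₃ hconv hlam x xF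
  have a2 := abs_le.1 (abs_smoothing_sub_regLoss_le hf hf₃ lam x)
  have a3 := abs_le.1 (abs_smoothing_sub_regLoss_le hf hf₃ lam xF)
  have a4 := integral_sq_norm_twoPoint_le hf hL₂.le hf₂ hf₃ hlam x
  have a5 := sq_norm_gradient_regLoss_le hf (M := 2 * L₁) (by positivity)
    (regLoss_gradient_lipschitz hd hf hL₁ hL₃ hf₁ hf₃ hlam') hxF x
  have a6 : 0 ≤ regLoss f lam x - regLoss f lam xF := sub_nonneg.2 (hxF (Set.mem_univ x))
  simp only [integral_const, probReal_univ, one_smul]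
  set I := ∫ u, ⟪twoPoint f lam x u, x - xF⟫ ∂(stdGaussian (EuclideanSpace ℝ (Fin d)))
  set J := ∫ u, ‖twoPoint f lam x u‖ ^ 2 ∂(stdGaussian (EuclideanSpace ℝ (Fin d)))
  set Δ := regLoss f lam x - regLoss f lam xF with hΔ
  set n : ℝ := (Nat.cast d : ℝ)
  have b1 : Δ - L₃ / 12 * lam ^ 4 * (n + 4) ^ 2 ≤ I := by
    have : L₃ * lam ^ 4 / 24 * (n * (n + 2)) ≤ L₃ * lam ^ 4 / 24 * (n + 4) ^ 2 := by
      gcongr; nlinarith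
    linarith [a2.1, a2.2, a3.1, a3.2]
  -- The step size satisfies η · 8(n+6)L₁ = 1, so the variance uses up exactly one of the two copies
  -- of `Δ` provided by `b1`.
  have b2 : η * J ≤ Δ + L₂ ^ 2 / (24 * L₁) * lam ^ 4 * (n + 6) ^ 3 +
      L₃ ^ 2 / (1152 * L₁) * lam ^ 6 * (n + 10) ^ 4 := by
    have c1 : J ≤ 8 * (n + 6) * L₁ * Δ + L₂ ^ 2 * lam ^ 4 * ((n + 6) ^ 4 / 3) +
        L₃ ^ 2 * lam ^ 6 / 144 * ((n + 6) * (n + 10) ^ 4) := by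
      have c2 : 2 * (n + 2) * ‖gradient (regLoss f lam) x‖ ^ 2 ≤ 8 * (n + 6) * L₁ * Δ :=
        calc _ ≤ 2 * (n + 2) * (2 * (2 * L₁) * Δ) := mul_le_mul_of_nonneg_left a5 (by positivity)
          _ = 8 * (n + 2) * (L₁ * Δ) := by ring
          _ ≤ 8 * (n + 6) * (L₁ * Δ) := by gcongr; norm_num
          _ = _ := by ring
      linarith
    calc η * J ≤ η * (8 * (n + 6) * L₁ * Δ + L₂ ^ 2 * lam ^ 4 * ((n + 6) ^ 4 / 3) +
        L₃ ^ 2 * lam ^ 6 / 144 * ((n + 6) * (n + 10) ^ 4)) := by gcongr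
      _ = _ := by
        rw [hη]
        field_simp
        ring
  have b1' := mul_le_mul_of_nonneg_left b1 (show 0 ≤ 2 * η by positivity)
  have b2' := mul_le_mul_of_nonneg_left b2 hηpos.le
  nlinarith

end OneStep

/-! ### Measurability, independence, telescoping and the random time. -/

section Iterates

open scoped ENNReal

variable {d : ℕ} {f : EuclideanSpace ℝ (Fin d) → ℝ}

lemma zoIterate_congr (f : EuclideanSpace ℝ (Fin d) → ℝ) (η lam : ℝ)
    (x₀ : EuclideanSpace ℝ (Fin d)) {u v : ℕ → EuclideanSpace ℝ (Fin d)} {t : ℕ}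
    (h : ∀ i < t, u i = v i) : zoIterate f η lam x₀ u t = zoIterate f η lam x₀ v t := by
  induction t with
  | zero => rfl
  | succ t ih =>
    rw [zoIterate, zoIterate, ih fun i hi => h i (hi.trans t.lt_succ_self), h t t.lt_succ_self]

lemma measurable_step (hf : Continuous f) (η lam : ℝ) :
    Measurable fun p : EuclideanSpace ℝ (Fin d) × EuclideanSpace ℝ (Fin d) =>
      p.1 - η • twoPoint f lam p.1 p.2 :=
  (continuous_fst.sub ((continuous_twoPoint hf lam).const_smul η)).measurable

lemma measurable_zoIterate (hf : Continuous f) (η lam : ℝ) (x₀ : EuclideanSpace ℝ (Fin d))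
    {α : Type*} [MeasurableSpace α] {u : α → ℕ → EuclideanSpace ℝ (Fin d)}
    (hu : ∀ i, Measurable fun a => u a i) (t : ℕ) :
    Measurable fun a => zoIterate f η lam x₀ (u a) t := by
  induction t with
  | zero => exact measurable_const
  | succ t ih => exact (measurable_step hf η lam).comp (ih.prodMk (hu t))

/-- Extend finitely many search directions by zero. -/
noncomputable def extendDirections (T : ℕ) (v : Fin T → EuclideanSpace ℝ (Fin d)) (i : ℕ) :
    EuclideanSpace ℝ (Fin d) :=
  if h : i < T then v ⟨i, h⟩ else 0

lemma measurable_extendDirections (T i : ℕ) :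
    Measurable fun v : Fin T → EuclideanSpace ℝ (Fin d) => extendDirections T v i := by
  unfold extendDirections
  split_ifs with h
  · exact measurable_pi_apply _
  · exact measurable_const

/-- Directions from time `T` on carry no measurability or law, so iterates are rewritten as
functions of the first `T` directions alone. -/
lemma zoIterate_extendDirections (f : EuclideanSpace ℝ (Fin d) → ℝ) (η lam : ℝ)
    (x₀ : EuclideanSpace ℝ (Fin d)) (u : ℕ → EuclideanSpace ℝ (Fin d)) {t T : ℕ} (ht : t ≤ T) :
    zoIterate f η lam x₀ (extendDirections T fun i => u i) t = zoIterate f η lam x₀ u t :=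
  zoIterate_congr f η lam x₀ fun i hi => by
    rw [extendDirections, dif_pos (hi.trans_le ht)]

variable {Ω : Type*} [MeasurableSpace Ω] {P : Measure Ω}
  {u : ℕ → Ω → EuclideanSpace ℝ (Fin d)} {T : ℕ}

lemma aemeasurable_zoIterate (hf : Continuous f) (η lam : ℝ) (x₀ : EuclideanSpace ℝ (Fin d))
    (hu : ∀ t < T, AEMeasurable (u t) P) {t : ℕ} (ht : t ≤ T) :
    AEMeasurable (fun ω => zoIterate f η lam x₀ (fun i => u i ω) t) P := by
  have h : (fun ω => zoIterate f η lam x₀ (fun i => u i ω) t) =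
      fun ω => zoIterate f η lam x₀ (extendDirections T fun i => u i ω) t :=
    funext fun ω => (zoIterate_extendDirections f η lam x₀ (fun i => u i ω) ht).symm
  rw [h]
  exact (measurable_zoIterate hf η lam x₀ (measurable_extendDirections T) t).comp_aemeasurable
    (aemeasurable_pi_lambda _ fun i : Fin T => hu i i.2)

/-- The iterate at time `t` is independent of the next search direction. -/
lemma indepFun_zoIterate (hf : Continuous f) (η lam : ℝ) (x₀ : EuclideanSpace ℝ (Fin d))
    (hu : ∀ t < T, AEMeasurable (u t) P) (hu_indep : iIndepFun (fun t : Fin T => u t) P)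
    {t : ℕ} (ht : t < T) :
    IndepFun (fun ω => zoIterate f η lam x₀ (fun i => u i ω) t) (u t) P := by
  classical
  let S : Finset (Fin T) := Finset.univ.filter fun i => (i : ℕ) < t
  let R : Finset (Fin T) := {⟨t, ht⟩}
  have hSR : Disjoint S R := by simp [S, R]
  have h := hu_indep.indepFun_finset₀ S R hSR fun i => hu i i.2
  let e : (S → EuclideanSpace ℝ (Fin d)) → ℕ → EuclideanSpace ℝ (Fin d) := fun v i =>
    if hi : i < t then v ⟨⟨i, hi.trans ht⟩, by simp [S, hi]⟩ else 0
  have he : ∀ i, Measurable fun v => e v i := fun i => by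
    by_cases hi : i < t
    · simp only [e, hi, dif_pos]; exact measurable_pi_apply _
    · simp only [e, hi, dif_neg, not_false_iff]; exact measurable_const
  have h' := h.comp (measurable_zoIterate hf η lam x₀ he t)
    (measurable_pi_apply (⟨⟨t, ht⟩, by simp [R]⟩ : R))
  convert h' using 1
  · ext1 ω
    refine zoIterate_congr f η lam x₀ fun i hi => ?_
    simp [e, hi]
  · rfl

/-- Telescoping a one-step drift inequality along the iterates. -/
lemma sum_lintegral_zoIterate_le [IsProbabilityMeasure P] (hf : Continuous f) {η lam : ℝ}
    (x₀ : EuclideanSpace ℝ (Fin d))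
    (hu : ∀ t < T, HasLaw (u t) (stdGaussian (EuclideanSpace ℝ (Fin d))) P)
    (hu_indep : iIndepFun (fun t : Fin T => u t) P)
    {W D : EuclideanSpace ℝ (Fin d) → ℝ≥0∞} (hW : Measurable W) (hD : Measurable D) {c : ℝ≥0∞}
    (hstep : ∀ x, ∫⁻ v, W (x - η • twoPoint f lam x v)
      ∂(stdGaussian (EuclideanSpace ℝ (Fin d))) + D x ≤ W x + c) {t : ℕ} (ht : t ≤ T) :
    ∫⁻ ω, W (zoIterate f η lam x₀ (fun i => u i ω) t) ∂P +
      ∑ s ∈ Finset.range t, ∫⁻ ω, D (zoIterate f η lam x₀ (fun i => u i ω) s) ∂P ≤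
      W x₀ + t * c := by
  have hu' : ∀ t < T, AEMeasurable (u t) P := fun t h => (hu t h).aemeasurable
  induction t with
  | zero => simp [zoIterate]
  | succ t ih =>
    have ht' : t < T := ht
    set X : Ω → EuclideanSpace ℝ (Fin d) := fun ω => zoIterate f η lam x₀ (fun i => u i ω) t with hX
    have hXm : AEMeasurable X P := aemeasurable_zoIterate hf η lam x₀ hu' ht'.le
    -- With a product joint law, Tonelli allows `hstep` to be applied at each frozen iterate.
    -- Working in `ℝ≥0∞` avoids any prior integrability of the iterates.
    have hind : P.map (fun ω => (X ω, u t ω)) =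
        (P.map X).prod (stdGaussian (EuclideanSpace ℝ (Fin d))) := by
      rw [← (hu t ht').map_eq]
      exact (indepFun_iff_map_prod_eq_prod_map_map hXm (hu' t ht')).1
        (indepFun_zoIterate hf η lam x₀ hu' hu_indep ht')
    have hm : Measurable fun p : EuclideanSpace ℝ (Fin d) × EuclideanSpace ℝ (Fin d) =>
        W (p.1 - η • twoPoint f lam p.1 p.2) := hW.comp (measurable_step hf η lam)
    have h1 : ∫⁻ ω, W (zoIterate f η lam x₀ (fun i => u i ω) (t + 1)) ∂P =
        ∫⁻ ω, ∫⁻ v, W (X ω - η • twoPoint f lam (X ω) v)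
          ∂(stdGaussian (EuclideanSpace ℝ (Fin d))) ∂P := by
      calc _ = ∫⁻ p, W (p.1 - η • twoPoint f lam p.1 p.2) ∂(P.map fun ω => (X ω, u t ω)) :=
            (lintegral_map' hm.aemeasurable (hXm.prodMk (hu' t ht'))).symm
        _ = _ := by
            rw [hind, lintegral_prod _ hm.aemeasurable,
              lintegral_map' hm.lintegral_prod_right'.aemeasurable hXm]
    have hDX : AEMeasurable (fun ω => D (X ω)) P := hD.comp_aemeasurable hXm
    have h2 : ∫⁻ ω, W (zoIterate f η lam x₀ (fun i => u i ω) (t + 1)) ∂P + ∫⁻ ω, D (X ω) ∂P ≤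
        ∫⁻ ω, W (X ω) ∂P + c := by
      rw [h1, ← lintegral_add_right' _ hDX]
      calc _ ≤ ∫⁻ ω, (W (X ω) + c) ∂P := lintegral_mono fun ω => hstep (X ω)
        _ = _ := by rw [lintegral_add_right _ measurable_const]; simp
    rw [Finset.sum_range_succ, add_comm (∑ s ∈ Finset.range t, _), ← add_assoc]
    calc _ ≤ ∫⁻ ω, W (X ω) ∂P + c +
          ∑ s ∈ Finset.range t, ∫⁻ ω, D (zoIterate f η lam x₀ (fun i => u i ω) s) ∂P := by
          gcongr
      _ = ∫⁻ ω, W (X ω) ∂P +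
          ∑ s ∈ Finset.range t, ∫⁻ ω, D (zoIterate f η lam x₀ (fun i => u i ω) s) ∂P + c := by
          rw [add_right_comm]
      _ ≤ W x₀ + t * c + c := add_le_add (ih ht'.le) le_rfl
      _ = _ := by push_cast; rw [add_assoc, add_mul, one_mul]

lemma measureReal_eq_of_hasLaw_uniformOn_Iio {τ : Ω → ℕ} (hτ : HasLaw τ (uniformOn (Set.Iio T)) P)
    {t : ℕ} (ht : t < T) : P.real {ω | τ ω = t} = 1 / T := by
  classical
  rw [hτ.measureReal_eq (p := fun k => k = t) (MeasurableSet.of_discrete), measureReal_def]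
  have h := uniformOn_apply_finset (s := Finset.range T) (t := {t})
  have h1 : ((Finset.range T : Finset ℕ) : Set ℕ) = Set.Iio T := by ext; simp
  have h2 : {x | x = t} = (({t} : Finset ℕ) : Set ℕ) := by ext; simp
  rw [h1] at h
  rw [h2, h, Finset.inter_singleton_of_mem (Finset.mem_range.2 ht)]
  simp

lemma ae_lt_of_hasLaw_uniformOn_Iio {τ : Ω → ℕ} (hτ : HasLaw τ (uniformOn (Set.Iio T)) P) :
    ∀ᵐ ω ∂P, τ ω < T := by
  rw [hτ.ae_iff (p := fun k => k < T) (measurable_of_countable _)]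
  exact ae_cond_mem (Set.finite_Iio T).measurableSet

/-- Averaging over an independent uniformly distributed time. -/
lemma integrable_and_integral_uniform_time [IsProbabilityMeasure P] {β : Type*} [MeasurableSpace β]
    {U : Ω → β} {τ : Ω → ℕ} (hτ : HasLaw τ (uniformOn (Set.Iio T)) P)
    (hind : IndepFun τ U P) {g : ℕ → β → ℝ} (hg : ∀ t, Measurable (g t))
    (hint : ∀ t < T, Integrable (fun ω => g t (U ω)) P) :
    Integrable (fun ω => g (τ ω) (U ω)) P ∧
      ∫ ω, g (τ ω) (U ω) ∂P = (1 / T) * ∑ t ∈ Finset.range T, ∫ ω, g t (U ω) ∂P := by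
  classical
  let χ : ℕ → ℕ → ℝ := fun t k => if k = t then 1 else 0
  have hχ : ∀ t, Measurable (χ t) := fun t => measurable_of_countable _
  have hχi : ∀ t, Integrable (fun ω => χ t (τ ω)) P := fun t =>
    Integrable.of_bound ((hχ t).comp_aemeasurable hτ.aemeasurable).aestronglyMeasurable 1
      (.of_forall fun ω => by simp only [χ]; split_ifs <;> simp)
  have hind' : ∀ t, IndepFun (fun ω => χ t (τ ω)) (fun ω => g t (U ω)) P := fun t =>
    hind.comp (hχ t) (hg t)
  have hprod : ∀ t ∈ Finset.range T, Integrable (fun ω => χ t (τ ω) * g t (U ω)) P := fun t ht =>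
    (hind' t).integrable_mul (hχi t) (hint t (Finset.mem_range.1 ht))
  -- Splitting by the value of `τ` turns the random index into a finite sum of products of
  -- independent factors.
  have hae : (fun ω => ∑ t ∈ Finset.range T, χ t (τ ω) * g t (U ω)) =ᵐ[P]
      fun ω => g (τ ω) (U ω) := by
    filter_upwards [ae_lt_of_hasLaw_uniformOn_Iio hτ] with ω hω
    simp [χ, hω]
  refine ⟨(integrable_finsetSum _ hprod).congr hae, ?_⟩
  rw [← integral_congr_ae hae, integral_finsetSum _ hprod, Finset.mul_sum]
  refine Finset.sum_congr rfl fun t ht => ?_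
  rw [(hind' t).integral_fun_mul_eq_mul_integral (hχi t).aestronglyMeasurable
    (hint t (Finset.mem_range.1 ht)).aestronglyMeasurable]
  congr 1
  rw [← measureReal_eq_of_hasLaw_uniformOn_Iio hτ (Finset.mem_range.1 ht)]
  have hs : NullMeasurableSet {ω | τ ω = t} P :=
    hτ.aemeasurable.nullMeasurableSet_preimage (measurableSet_singleton t)
  have : (fun ω => χ t (τ ω)) = Set.indicator {ω | τ ω = t} (fun _ => (1 : ℝ)) := by
    ext ω; simp [χ, Set.indicator_apply]
  rw [this, integral_indicator₀ hs]
  simp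

end Iterates

theorem theorem1 {d : ℕ} (hd : 1 ≤ d) (f : EuclideanSpace ℝ (Fin d) → ℝ) (L₁ L₂ L₃ : ℝ)
    (hL₁ : 0 < L₁) (hL₂ : 0 < L₂) (hL₃ : 0 < L₃)
    (hf : ContDiff ℝ 3 f)
    (hf₁ : FirstOrderSmooth f L₁) (hf₂ : SecondOrderSmooth f L₂) (hf₃ : ThirdOrderSmooth f L₃)
    (hconv : ConvexOn ℝ Set.univ f)
    (η lam : ℝ) (hη : η = 1 / (8 * ((d : ℝ) + 6) * L₁)) (hlam : 0 < lam)
    (hlam' : lam ^ 2 ≤ √2 * L₁ / ((d : ℝ) ^ (3 / 2 : ℝ) * L₃))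
    (x₀ xF : EuclideanSpace ℝ (Fin d)) (hxF : IsMinOn (regLoss f lam) Set.univ xF)
    (T : ℕ) (hT : 1 ≤ T)
    {Ω : Type*} [MeasurableSpace Ω] (P : Measure Ω) [IsProbabilityMeasure P]
    (u : ℕ → Ω → EuclideanSpace ℝ (Fin d)) (τ : Ω → ℕ)
    (hu : ∀ t < T, HasLaw (u t) (stdGaussian (EuclideanSpace ℝ (Fin d))) P)
    (hu_indep : iIndepFun (fun t : Fin T => u t) P)
    (hτ : HasLaw τ (uniformOn (Set.Iio T)) P)
    (hτ_indep : IndepFun τ (fun ω (t : Fin T) => u t ω) P) :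
    Integrable
        (fun ω => regLoss f lam (zoIterate f η lam x₀ (fun t => u t ω) (τ ω)) - regLoss f lam xF) P ∧
      ∫ ω, (regLoss f lam (zoIterate f η lam x₀ (fun t => u t ω) (τ ω)) - regLoss f lam xF) ∂P ≤
        8 * ((d : ℝ) + 6) * L₁ * ‖x₀ - xF‖ ^ 2 / T
          + L₃ / 6 * lam ^ 4 * ((d : ℝ) + 4) ^ 2
          + L₂ ^ 2 / (24 * L₁) * lam ^ 4 * ((d : ℝ) + 6) ^ 3
          + L₃ ^ 2 / (1152 * L₁) * lam ^ 6 * ((d : ℝ) + 10) ^ 4 := by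
  have hT' : (0 : ℝ) < T := by exact_mod_cast hT
  have hηpos : 0 < η := by rw [hη]; positivity
  set E := L₃ / 6 * lam ^ 4 * ((d : ℝ) + 4) ^ 2
          + L₂ ^ 2 / (24 * L₁) * lam ^ 4 * ((d : ℝ) + 6) ^ 3
          + L₃ ^ 2 / (1152 * L₁) * lam ^ 6 * ((d : ℝ) + 10) ^ 4 with hE
  have hEpos : 0 ≤ E := by positivity
  set Δ : EuclideanSpace ℝ (Fin d) → ℝ := fun x => regLoss f lam x - regLoss f lam xF with hΔ
  have hΔ0 : ∀ x, 0 ≤ Δ x := fun x => sub_nonneg.2 (hxF (Set.mem_univ x))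
  have hΔm : Measurable Δ := ((contDiff_regLoss hf lam).continuous.sub continuous_const).measurable
  have hstep : ∀ x, ∫⁻ v, ENNReal.ofReal (‖x - η • twoPoint f lam x v - xF‖ ^ 2)
      ∂(stdGaussian (EuclideanSpace ℝ (Fin d))) + ENNReal.ofReal (η * Δ x) ≤
      ENNReal.ofReal (‖x - xF‖ ^ 2) + ENNReal.ofReal (η * E) := by
    intro x
    obtain ⟨h1, h2⟩ := integral_sq_dist_step_le hd hL₁ hL₂ hL₃ hf hf₁ hf₂ hf₃ hconv hη hlam hlam'
      hxF x
    rw [← ofReal_integral_eq_lintegral_ofReal h1 (.of_forall fun _ => sq_nonneg _),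
      ← ENNReal.ofReal_add (integral_nonneg fun _ => sq_nonneg _)
        (mul_nonneg hηpos.le (hΔ0 x)), ← ENNReal.ofReal_add (sq_nonneg _) (by positivity)]
    exact ENNReal.ofReal_le_ofReal h2
  have hsum := sum_lintegral_zoIterate_le hf.continuous x₀ hu hu_indep
    (W := fun x => ENNReal.ofReal (‖x - xF‖ ^ 2)) (D := fun x => ENNReal.ofReal (η * Δ x))
    (by fun_prop) (by fun_prop) hstep le_rfl
  -- The final squared distance is discarded.
  replace hsum := le_add_self.trans hsum
  set X : ℕ → Ω → EuclideanSpace ℝ (Fin d) :=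
    fun t ω => zoIterate f η lam x₀ (fun i => u i ω) t with hX
  have hXm : ∀ t < T, AEMeasurable (X t) P := fun t ht =>
    aemeasurable_zoIterate hf.continuous η lam x₀ (fun s hs => (hu s hs).aemeasurable) ht.le
  have hfin : ENNReal.ofReal (‖x₀ - xF‖ ^ 2) + T * ENNReal.ofReal (η * E) ≠ ⊤ :=
    ENNReal.add_ne_top.2 ⟨ENNReal.ofReal_ne_top,
      ENNReal.mul_ne_top (ENNReal.natCast_ne_top T) ENNReal.ofReal_ne_top⟩
  -- Each term is nonnegative and part of a finite sum, which yields integrability.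
  have hηΔ : ∀ t < T, Integrable (fun ω => η * Δ (X t ω)) P := fun t ht => by
    refine ⟨((hΔm.comp_aemeasurable (hXm t ht)).const_mul η).aestronglyMeasurable, ?_⟩
    rw [hasFiniteIntegral_iff_ofReal (.of_forall fun ω => mul_nonneg hηpos.le (hΔ0 _))]
    exact ((Finset.single_le_sum_of_canonicallyOrdered (Finset.mem_range.2 ht)).trans
      hsum).trans_lt hfin.lt_top
  have hint : ∀ t < T, Integrable (fun ω => Δ (X t ω)) P := fun t ht =>
    (integrable_const_mul_iff (isUnit_iff_ne_zero.2 hηpos.ne') _).1 (hηΔ t ht)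
  have hsum' : η * ∑ t ∈ Finset.range T, ∫ ω, Δ (X t ω) ∂P ≤ ‖x₀ - xF‖ ^ 2 + T * (η * E) := by
    rw [← ENNReal.ofReal_le_ofReal_iff (by positivity), ENNReal.ofReal_add (by positivity)
      (by positivity), ENNReal.ofReal_mul (p := (T : ℝ)) (by positivity), ENNReal.ofReal_natCast]
    refine le_trans (le_of_eq ?_) hsum
    rw [Finset.mul_sum, ENNReal.ofReal_sum_of_nonneg fun t _ =>
      mul_nonneg hηpos.le (integral_nonneg fun ω => hΔ0 _)]
    refine Finset.sum_congr rfl fun t ht => ?_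
    rw [← integral_const_mul, ofReal_integral_eq_lintegral_ofReal (hηΔ t (Finset.mem_range.1 ht))
      (.of_forall fun ω => mul_nonneg hηpos.le (hΔ0 _))]
  set U : Ω → Fin T → EuclideanSpace ℝ (Fin d) := fun ω t => u t ω with hU
  -- `τ` is independent only of the first `T` directions, so the gap must be a measurable function
  -- of these.
  let g : ℕ → (Fin T → EuclideanSpace ℝ (Fin d)) → ℝ := fun t v =>
    Δ (zoIterate f η lam x₀ (extendDirections T v) t)
  have hg : ∀ t, Measurable (g t) := fun t =>
    hΔm.comp (measurable_zoIterate hf.continuous η lam x₀ (measurable_extendDirections T) t)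
  have hgX : ∀ t < T, ∀ ω, g t (U ω) = Δ (X t ω) := fun t ht ω =>
    congrArg Δ (zoIterate_extendDirections f η lam x₀ (fun i => u i ω) ht.le)
  obtain ⟨hI, hJ⟩ := integrable_and_integral_uniform_time hτ hτ_indep hg fun t ht => by
    simp_rw [hgX t ht]; exact hint t ht
  have hae : (fun ω => g (τ ω) (U ω)) =ᵐ[P] fun ω => Δ (X (τ ω) ω) := by
    filter_upwards [ae_lt_of_hasLaw_uniformOn_Iio hτ] with ω hω using hgX _ hω ω
  refine ⟨hI.congr hae, ?_⟩
  have hJ' : ∫ ω, Δ (X (τ ω) ω) ∂P = (1 / T) * ∑ t ∈ Finset.range T, ∫ ω, Δ (X t ω) ∂P := by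
    rw [← integral_congr_ae hae, hJ]
    congr 1
    refine Finset.sum_congr rfl fun t ht => ?_
    simp_rw [hgX t (Finset.mem_range.1 ht)]
  calc ∫ ω, Δ (X (τ ω) ω) ∂P = (1 / (η * T)) * (η * ∑ t ∈ Finset.range T, ∫ ω, Δ (X t ω) ∂P) := by
        rw [hJ']; field_simp
    _ ≤ (1 / (η * T)) * (‖x₀ - xF‖ ^ 2 + T * (η * E)) := by gcongr
    _ = ‖x₀ - xF‖ ^ 2 / (η * T) + E := by field_simp
    _ = _ := by
      rw [hE, hη]
      field_simp
      ring
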